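/- Let $n\ge 1$, $\ell\ge 1$, $m\ge 0$ be integers and let $X_1,\dots,X_n$ be random variables on a common probability space with values in a measurable space $\mathcal S$. Assume that they admit a dependency graph of maximal degree at most $m$: a graph on $\{1,\dots,n\}$ such that, whenever $V_1,V_2\subset\{1,\dots,n\}$ are disjoint and no edge joins $V_1$ to $V_2$, the families $(X_k)_{k\in V_1}$ and $(X_k)_{k\in V_2}$ are independent. Let $\Lambda_{n,\ell}$ be the set of $\ell$-tuples $\alpha=(\alpha_1,\dots,\alpha_\ell)$ of pairwise distinct elements of $\{1,\dots,n\}$, and write $X_\alpha=(X_{\alpha_1},\dots,X_{\alpha_\ell})$. Let $f:\mathcal S^\ell\to\mathbb R$ be measurable, let $(c_\alpha)_{\alpha\in\Lambda_{n,\ell}}$ be arbitrary real numbers, let $\delta\in(2,\infty)$, and assume $$\mathcal A_\delta:=\sum_{\alpha\in\Lambda_{n,\ell}}\|f(X_\alpha)-c_\alpha\|_{L^\delta}^\delta\in(0,\infty).$$ Define $$U_n=\frac{1}{\ell!\binom n\ell}\sum_{\alpha\in\Lambda_{n,\ell}}f(X_\alpha),\qquad V_n=\ell!\binom n\ell U_n,\qquad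 \mathbf a_\delta=\left(\frac{\mathcal A_\delta}{|\Lambda_{n,\ell}|}\right)^{1/\delta},\qquad \Xi_\delta=\frac1{\mathbf a_\delta}\sqrt{\frac{\operatorname{Var}[V_n]}{\ell^2(m+1)\,n^{2\ell-1}}},$$ and assume $\operatorname{Var}[U_n]\ne 0$. Let $d_{\mathrm{Kol}}(P,Q)=\sup_{t\in\mathbb R}|P((-\infty,t])-Q((-\infty,t])|$ denote the Kolmogorov distance and let $W$ be the distribution of $(U_n-\mathbb E[U_n])/\sqrt{\operatorname{Var}[U_n]}$. Then $\Xi_\delta\in(0,1]$, and: * if $\delta\in(2,3)$, then $$d_{\mathrm{Kol}}\big(W,\mathcal N(0,1)\big)\le 8.015\left(\frac{\ell^2(m+1)}{n}\right)^{\frac{\delta-2}{2(\delta+1)}}\Xi_\delta^{-\frac{\delta}{\delta+1}};$$ * if $\delta\in[3,\infty)$, then $$d_{\mathrm{Kol}}\big(W,\mathcal N(0,1)\big)\le\max\left\{18.96\left(\frac{\ell^2(m+1)}{n}\right)^{\frac{\delta-2}{2(\delta+1)}}\Xi_\delta^{-\frac{\delta}{\delta+1}},\ 227.5\sqrt{\frac{\ell^2(m+1)}{n}}\;\Xi_\delta^{-3}\right\}.$$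 -/

import Mathlib

open MeasureTheory ProbabilityTheory
open scoped ENNReal Nat

namespace UStatistics

noncomputable section

/-- A graph `G` on `V` is a dependency graph of the family `(X k)` if, whenever `V₁` and `V₂` are
disjoint sets of vertices with no edge between them, the families `(X k)_{k ∈ V₁}` and
`(X k)_{k ∈ V₂}` are independent. -/
def IsDependencyGraph {Ω S V : Type*} [MeasurableSpace Ω] [MeasurableSpace S]
    (G : SimpleGraph V) (X : V → Ω → S) (μ : Measure Ω) : Prop :=
  ∀ V₁ V₂ : Set V, Disjoint V₁ V₂ → (∀ i ∈ V₁, ∀ j ∈ V₂, ¬ G.Adj i j) →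
    IndepFun (fun (ω : Ω) (i : V₁) => X i ω) (fun (ω : Ω) (j : V₂) => X j ω) μ

/-- The Kolmogorov distance `sup_t |P((-∞, t]) - Q((-∞, t])|` of two probability measures
on the real line. -/
def kolDist (P Q : Measure ℝ) : ℝ :=
  ⨆ t : ℝ, |P.real (Set.Iic t) - Q.real (Set.Iic t)|

/-- `Λ n ℓ` is the set of `ℓ`-tuples of pairwise distinct elements of an `n`-element set of
indices. -/
abbrev Λ (n ℓ : ℕ) : Type := Fin ℓ ↪ Fin n

/-- The tuple `X_α = (X_{α_1}, …, X_{α_ℓ})`. -/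
def tuple {Ω S : Type*} {n ℓ : ℕ} (X : Fin n → Ω → S) (α : Λ n ℓ) (ω : Ω) : Fin ℓ → S :=
  fun i => X (α i) ω

/-- The U-statistic `U_n` of order `ℓ` with kernel `f`. -/
def uStat {Ω S : Type*} {n ℓ : ℕ} (f : (Fin ℓ → S) → ℝ) (X : Fin n → Ω → S) (ω : Ω) : ℝ :=
  1 / ((ℓ ! : ℝ) * (n.choose ℓ : ℝ)) * ∑ α : Λ n ℓ, f (tuple X α ω)

/-- The non-normalized U-statistic `V_n = ℓ! (n choose ℓ) U_n`. -/
def vStat {Ω S : Type*} {n ℓ : ℕ} (f : (Fin ℓ → S) → ℝ) (X : Fin n → Ω → S) (ω : Ω) : ℝ :=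
  (ℓ ! : ℝ) * (n.choose ℓ : ℝ) * uStat f X ω

/-- `A_δ = ∑_α ‖f(X_α) - c_α‖_δ ^ δ`, as an extended nonnegative number. -/
def momentSum {Ω S : Type*} [MeasurableSpace Ω] {n ℓ : ℕ} (f : (Fin ℓ → S) → ℝ)
    (X : Fin n → Ω → S) (c : Λ n ℓ → ℝ) (δ : ℝ) (μ : Measure Ω) : ℝ≥0∞ :=
  ∑ α : Λ n ℓ, (eLpNorm (fun ω => f (tuple X α ω) - c α) (ENNReal.ofReal δ) μ) ^ δ

/-- `a_δ = (A_δ / |Λ n ℓ|) ^ (1 / δ)`. -/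
def meanNorm {Ω S : Type*} [MeasurableSpace Ω] {n ℓ : ℕ} (f : (Fin ℓ → S) → ℝ)
    (X : Fin n → Ω → S) (c : Λ n ℓ → ℝ) (δ : ℝ) (μ : Measure Ω) : ℝ :=
  ((momentSum f X c δ μ).toReal / (Fintype.card (Λ n ℓ) : ℝ)) ^ (1 / δ)

/-- `Ξ_δ = a_δ⁻¹ √(Var[V_n] / (ℓ² (m + 1) n^(2ℓ - 1)))`, used for `1 ≤ ℓ`. -/
def Xi {Ω S : Type*} [MeasurableSpace Ω] {n ℓ : ℕ} (f : (Fin ℓ → S) → ℝ)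
    (X : Fin n → Ω → S) (c : Λ n ℓ → ℝ) (m : ℕ) (δ : ℝ) (μ : Measure Ω) : ℝ :=
  1 / meanNorm f X c δ μ *
    √(variance (vStat f X) μ / ((ℓ : ℝ) ^ 2 * ((m : ℝ) + 1) * (n : ℝ) ^ (2 * ℓ - 1)))

/-- The distribution of `(U_n - E[U_n]) / √Var[U_n]`. -/
def normalizedLaw {Ω S : Type*} [MeasurableSpace Ω] {n ℓ : ℕ} (f : (Fin ℓ → S) → ℝ)
    (X : Fin n → Ω → S) (μ : Measure Ω) : Measure ℝ :=
  μ.map (fun ω => (uStat f X ω - ∫ ω', uStat f X ω' ∂μ) / √(variance (uStat f X) μ))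

end

end UStatistics

/-!
The normalized U-statistic is a centred sum `W = ∑ (η_α - E[η_α])` of the scaled terms
`η_α = (f(X_α) - c_α) / σ`, where `σ` is the standard deviation of `V_n`. A term `η_α` depends only
on the terms `η_β` whose tuple `β` shares an index with `α` or contains a neighbour of one; there
are at most `D = ℓ² (m + 1) n^(ℓ-1)` of them (`card_tupleNbhd_le`, `indepFun_of_tupleNbhd`). This is
the setting of Stein's method for locally dependent sums of variance one (`IsLocallyDependent`).

*Stein's equation.* The indicator of a half-line is smoothed to a `C¹` function with transition on
an interval of length `2 ε`, at the cost of `0.8 ε` in the Kolmogorov distance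
(`abs_measureReal_Iic_sub_gaussian_le`). The bounded solution `f` of the Stein equation, its
derivative `f'` and `f''` are controlled by a maximum principle (`mul_mem_of_stein`,
`exists_isSteinSolution`): `|f| ≤ 1.26`, `|f'| ≤ 1`, and `|f''|` is of order `1 / ε`, or even of
order `1 + |w|` outside the transition interval.

*Local dependence.* Comparing `f(W)` with `f` at the sum without the neighbourhood of `i`, and
`f'(W)` with `f'` at the sum without the neighbourhoods of `i` and `j`, bounds the error
`|E[f'(W) - W f(W)]|` by increments of `f'` (`abs_integral_stein_le`). The removed summands are not
centred: a constant shift does not affect independence, and in this way only `|η_α|`, and no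
absolute central moments, have to be estimated.

*Moments of order `δ ∈ (2, 3]`.* Interpolating between `|f'| ≤ 1` and `|f''| ≲ 1 / ε`, the
increments of `f'` are Hölder continuous of order `δ - 2`. If `x` satisfies
`D^(δ-1) ∑ E|η_α|^δ ≤ x^(δ+1)` and `ε = 3 x`, the resulting bound is `4 x`
(`kolDist_le_of_le_three`).

*Moments of order `δ ≥ 3`.* When all the neighbourhood sums of a triple `i, j, k` are at most `x`,
the value of `f''` is controlled by the sum without these neighbourhoods, which is independent of
the triple; it meets the transition interval with a probability that is bounded by the length of
the interval and by the Kolmogorov distance `κ` itself (`integral_localBound_le`). The other event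
is absorbed by the moments of order `δ`. With `β = D² ∑ E|η_α|³` and `ε = 40 β + x / 2` this gives
`κ ≤ κ / 2 + …`, hence `κ ≤ 133 β + 6.3 x` (`kolDist_le_of_three_le`).

*Scaling.* Power means (`sum_integral_rpow_le`) turn the assumption on `A_δ` into
`D^(q-1) ∑ E|η_α|^q ≤ (ℓ² (m + 1) / n)^((q-2)/2) Ξ^(-q)` for all `q ∈ [0, δ]` (`moment_scaling`).
The case `q = δ` gives `x`, the case `q = 3` gives `β`, and the case `q = 2` gives `Ξ ≤ 1`, since
the variance `1` is a sum of covariances of neighbours (`one_le_mul_sum_sq`). For large `x` the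
claim is trivial because the Kolmogorov distance is at most one.
-/

namespace UStatistics

/-! ### The smoothed indicator of a half-line -/

/-- A continuously differentiable function that is `1` on `(-∞, 0]` and `0` on `[2, ∞)`; its
derivative is minus the tent function on `[0, 2]`. -/
noncomputable def smoothStep (u : ℝ) : ℝ :=
  1 - ((max 0 u) ^ 2 - 2 * (max 0 (u - 1)) ^ 2 + (max 0 (u - 2)) ^ 2) / 2

/-- Minus the tent function on `[0, 2]`. -/
noncomputable def smoothStepDeriv (u : ℝ) : ℝ :=
  -(max 0 u - 2 * max 0 (u - 1) + max 0 (u - 2))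

theorem hasDerivAt_max_zero_sq (u : ℝ) :
    HasDerivAt (fun u : ℝ => (max 0 u) ^ 2) (2 * max 0 u) u := by
  rcases lt_trichotomy u 0 with h | h | h
  · have h1 : (fun u : ℝ => (max 0 u) ^ 2) =ᶠ[nhds u] fun _ => 0 := by
      filter_upwards [gt_mem_nhds h] with v hv
      simp [max_eq_left hv.le]
    rw [max_eq_left h.le, mul_zero]
    exact (hasDerivAt_const u (0 : ℝ)).congr_of_eventuallyEq h1
  · subst h
    rw [hasDerivAt_iff_isLittleO_nhds_zero]
    simp only [zero_add, max_self, mul_zero, smul_zero, sub_zero, ne_eq, OfNat.ofNat_ne_zero,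
      not_false_eq_true, zero_pow]
    have h2 : (fun h : ℝ => (max 0 h) ^ 2) =O[nhds 0] fun h : ℝ => h ^ 2 := by
      refine Asymptotics.IsBigO.of_bound 1 (Filter.Eventually.of_forall fun h => ?_)
      rw [one_mul, Real.norm_eq_abs, Real.norm_eq_abs, abs_of_nonneg (sq_nonneg _),
        abs_of_nonneg (sq_nonneg _)]
      rcases le_total 0 h with h0 | h0 <;> simp [h0, sq_nonneg]
    refine h2.trans_isLittleO ?_
    simpa using (Asymptotics.isLittleO_pow_id (𝕜 := ℝ) (n := 2) (by norm_num))
  · have h1 : (fun u : ℝ => (max 0 u) ^ 2) =ᶠ[nhds u] fun v => v ^ 2 := by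
      filter_upwards [lt_mem_nhds h] with v hv
      simp [max_eq_right hv.le]
    rw [max_eq_right h.le]
    simpa using (hasDerivAt_pow 2 u).congr_of_eventuallyEq h1

theorem hasDerivAt_smoothStep (u : ℝ) : HasDerivAt smoothStep (smoothStepDeriv u) u := by
  have h0 := hasDerivAt_max_zero_sq u
  have h1 := (hasDerivAt_max_zero_sq (u - 1)).comp_sub_const u 1
  have h2 := (hasDerivAt_max_zero_sq (u - 2)).comp_sub_const u 2
  have := (((h0.sub (h1.const_mul 2)).add h2).div_const 2).const_sub 1
  refine this.congr_deriv ?_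
  unfold smoothStepDeriv
  ring

theorem smoothStep_of_nonpos {u : ℝ} (hu : u ≤ 0) : smoothStep u = 1 := by
  unfold smoothStep
  rw [max_eq_left hu, max_eq_left (by linarith), max_eq_left (by linarith)]
  norm_num

theorem smoothStep_of_two_le {u : ℝ} (hu : 2 ≤ u) : smoothStep u = 0 := by
  unfold smoothStep
  rw [max_eq_right (by linarith), max_eq_right (by linarith), max_eq_right (by linarith)]
  ring

theorem smoothStepDeriv_mem (u : ℝ) : smoothStepDeriv u ∈ Set.Icc (-1 : ℝ) 0 := by
  unfold smoothStepDeriv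
  rcases max_cases 0 u with h0 | h0 <;> rcases max_cases 0 (u - 1) with h1 | h1 <;>
    rcases max_cases 0 (u - 2) with h2 | h2 <;> constructor <;> linarith

theorem smoothStepDeriv_eq_zero {u : ℝ} (hu : u ∉ Set.Ioo (0 : ℝ) 2) : smoothStepDeriv u = 0 := by
  unfold smoothStepDeriv
  rcases le_or_gt u 0 with h | h
  · rw [max_eq_left h, max_eq_left (by linarith), max_eq_left (by linarith)]
    norm_num
  · have h2 : 2 ≤ u := by
      by_contra h2
      exact hu ⟨h, not_le.1 h2⟩
    rw [max_eq_right (by linarith), max_eq_right (by linarith), max_eq_right (by linarith)]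
    ring

theorem antitone_smoothStep : Antitone smoothStep :=
  antitone_of_hasDerivAt_nonpos hasDerivAt_smoothStep fun u => (smoothStepDeriv_mem u).2

theorem smoothStep_mem (u : ℝ) : smoothStep u ∈ Set.Icc (0 : ℝ) 1 := by
  constructor
  · rw [← smoothStep_of_two_le (le_max_right u 2)]
    exact antitone_smoothStep (le_max_left u 2)
  · rw [← smoothStep_of_nonpos (min_le_right u 0)]
    exact antitone_smoothStep (min_le_left u 0)

/-! ### Bounded solutions of the Stein equation -/

/-- A maximum principle for `g' - w g = r` on the half-line: if `g` is bounded and `r ≥ -R`, then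
`e^{-w²/2} (g(w) - R / w₀)` increases to `0` on `[w₀, ∞)`. -/
theorem mul_le_of_stein_pos {g g' : ℝ → ℝ} {K R : ℝ} (hg : ∀ w, HasDerivAt g (g' w) w)
    (hK : ∀ w, |g w| ≤ K) (hR : 0 ≤ R) (h : ∀ w, -R ≤ g' w - w * g w) {w₀ : ℝ} (hw : 0 < w₀) :
    w₀ * g w₀ ≤ R := by
  set q : ℝ → ℝ := fun w => Real.exp (-(1 / 2) * w ^ 2) * (g w - R / w₀) with hq
  have hd : ∀ w, HasDerivAt q (Real.exp (-(1 / 2) * w ^ 2) * (g' w - w * g w + R * (w / w₀))) w := by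
    intro w
    have h1 : HasDerivAt (fun w : ℝ => Real.exp (-(1 / 2) * w ^ 2))
        (Real.exp (-(1 / 2) * w ^ 2) * (-(1 / 2) * (2 * w))) w := by
      have := ((hasDerivAt_pow 2 w).const_mul (-(1 / 2 : ℝ))).exp
      simpa using this
    refine (h1.mul ((hg w).sub_const (R / w₀))).congr_deriv ?_
    ring
  have hmono : MonotoneOn q (Set.Ici w₀) := by
    refine monotoneOn_of_deriv_nonneg (convex_Ici w₀)
      (fun w _ => (hd w).continuousAt.continuousWithinAt)
      (fun w _ => (hd w).differentiableAt.differentiableWithinAt) fun w hw' => ?_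
    rw [interior_Ici, Set.mem_Ioi] at hw'
    rw [(hd w).deriv]
    have h1 : 1 ≤ w / w₀ := (one_le_div hw).2 hw'.le
    have h2 : 0 ≤ R * (w / w₀ - 1) := mul_nonneg hR (by linarith)
    exact mul_nonneg (Real.exp_pos _).le (by linarith [h w])
  have hlim : Filter.Tendsto q Filter.atTop (nhds 0) := by
    have h1 : Filter.Tendsto (fun w : ℝ => Real.exp (-(1 / 2) * w ^ 2)) Filter.atTop (nhds 0) := by
      refine Real.tendsto_exp_atBot.comp ?_
      exact (Filter.tendsto_pow_atTop (by norm_num)).const_mul_atTop_of_neg (by norm_num)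
    refine h1.zero_mul_isBoundedUnder_le ⟨K + |R / w₀|, ?_⟩
    refine Filter.eventually_map.2 (Filter.Eventually.of_forall fun w => ?_)
    exact (abs_sub _ _).trans (add_le_add_left (hK w) _)
  have hle : q w₀ ≤ 0 := ge_of_tendsto hlim <| by
    filter_upwards [Filter.eventually_ge_atTop w₀] with w hw'
    exact hmono Set.self_mem_Ici hw' hw'
  have h3 : g w₀ ≤ R / w₀ := by
    by_contra hcon
    have := mul_pos (Real.exp_pos (-(1 / 2) * w₀ ^ 2)) (sub_pos.2 (not_le.1 hcon))
    exact absurd hle (not_le.2 this)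
  rwa [le_div_iff₀' hw] at h3

/-- A bounded solution `g` of `g' - w g = r` with `-R₁ ≤ r ≤ R₂` satisfies `-R₂ ≤ w g ≤ R₁`. -/
theorem mul_mem_of_stein {g g' : ℝ → ℝ} {K R₁ R₂ : ℝ} (hg : ∀ w, HasDerivAt g (g' w) w)
    (hK : ∀ w, |g w| ≤ K) (hR₁ : 0 ≤ R₁) (hR₂ : 0 ≤ R₂)
    (h : ∀ w, g' w - w * g w ∈ Set.Icc (-R₁) R₂) (w : ℝ) : w * g w ∈ Set.Icc (-R₂) R₁ := by
  -- The four cases (sign of `w`, side of the bound) follow from one by `g ↦ -g` and `w ↦ -w`.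
  have hneg : ∀ w, HasDerivAt (fun w => g (-w)) (-g' (-w)) w := fun w =>
    ((hg (-w)).scomp w (hasDerivAt_neg w)).congr_deriv (by simp)
  rcases lt_trichotomy w 0 with hw | hw | hw
  · constructor
    · have := mul_le_of_stein_pos (g := fun w => g (-w)) (K := K) hneg (fun w => hK _) hR₂
        (fun v => by linarith [(h (-v)).2]) (neg_pos.2 hw)
      simp only [neg_neg] at this
      linarith
    · have := mul_le_of_stein_pos (g := fun w => -g (-w)) (K := K) (fun v => (hneg v).neg)
        (fun w => by rw [abs_neg]; exact hK _) hR₁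
        (fun v => by linarith [(h (-v)).1]) (neg_pos.2 hw)
      simp only [neg_neg] at this
      linarith
  · subst hw
    simp [hR₁, hR₂]
  · constructor
    · have := mul_le_of_stein_pos (g := fun w => -g w) (K := K) (fun v => (hg v).neg)
        (fun w => by rw [abs_neg]; exact hK _) hR₂ (fun v => by linarith [(h v).2]) hw
      linarith
    · exact mul_le_of_stein_pos hg hK hR₁ (fun v => (h v).1) hw

theorem integrable_exp_neg_half_sq : Integrable fun t : ℝ => Real.exp (-(1 / 2) * t ^ 2) :=
  integrable_exp_neg_mul_sq (by norm_num)

theorem sqrt_two_pi_half_le : √(Real.pi / (1 / 2)) / 2 ≤ 1.26 := by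
  have : √(Real.pi / (1 / 2)) ≤ 2.52 := by
    rw [Real.sqrt_le_left (by norm_num)]
    linarith [Real.pi_lt_d2]
  linarith

theorem integral_Ioi_exp_neg_half_sq_le {w : ℝ} (hw : 0 ≤ w) :
    ∫ t in Set.Ioi w, Real.exp (-(1 / 2) * t ^ 2) ≤ 1.26 * Real.exp (-(1 / 2) * w ^ 2) := by
  have h1 : ∫ t in Set.Ioi w, Real.exp (-(1 / 2) * (t - w) ^ 2)
      = ∫ t in Set.Ioi (0 : ℝ), Real.exp (-(1 / 2) * t ^ 2) := by
    have := (measurePreserving_sub_right (volume : Measure ℝ) w).setIntegral_preimage_emb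
      (MeasurableEquiv.subRight w).measurableEmbedding
      (fun t => Real.exp (-(1 / 2) * t ^ 2)) (Set.Ioi 0)
    rw [← this]
    congr 2
    ext t
    simp
  have h2 : ∫ t in Set.Ioi w, Real.exp (-(1 / 2) * t ^ 2)
      ≤ ∫ t in Set.Ioi w, Real.exp (-(1 / 2) * w ^ 2) * Real.exp (-(1 / 2) * (t - w) ^ 2) := by
    refine setIntegral_mono_on integrable_exp_neg_half_sq.integrableOn ?_ measurableSet_Ioi ?_
    · exact ((integrable_exp_neg_half_sq.comp_sub_right w).const_mul _).integrableOn
    · intro t ht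
      rw [← Real.exp_add, Real.exp_le_exp]
      nlinarith [mul_nonneg hw (sub_nonneg.2 (le_of_lt (Set.mem_Ioi.1 ht)))]
  rw [integral_const_mul, h1, integral_gaussian_Ioi, mul_comm] at h2
  exact h2.trans (mul_le_mul_of_nonneg_right sqrt_two_pi_half_le (Real.exp_pos _).le)

theorem integral_Iic_exp_neg_half_sq_le {w : ℝ} (hw : w ≤ 0) :
    ∫ t in Set.Iic w, Real.exp (-(1 / 2) * t ^ 2) ≤ 1.26 * Real.exp (-(1 / 2) * w ^ 2) := by
  have h := integral_comp_neg_Iic w fun t => Real.exp (-(1 / 2) * t ^ 2)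
  simp only [neg_sq] at h
  rw [h]
  simpa using integral_Ioi_exp_neg_half_sq_le (neg_nonneg.2 hw)

theorem integral_gaussianReal_zero_one (h : ℝ → ℝ) :
    ∫ t, h t ∂(gaussianReal 0 1) =
      (√(2 * Real.pi))⁻¹ * ∫ t, h t * Real.exp (-(1 / 2) * t ^ 2) := by
  rw [integral_gaussianReal_eq_integral_smul (by norm_num), ← integral_const_mul]
  refine integral_congr_ae (Filter.Eventually.of_forall fun t => ?_)
  simp only [gaussianPDFReal, NNReal.coe_one, mul_one, sub_zero, smul_eq_mul]
  rw [show -t ^ 2 / 2 = -(1 / 2) * t ^ 2 by ring]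
  ring

/-- The Stein equation for a continuous `h` with values in `[0, 1]` has a solution bounded by
`1.26`, an upper bound of `√(π / 2)`. -/
theorem exists_stein_solution {h : ℝ → ℝ} (hc : Continuous h) (h01 : ∀ w, h w ∈ Set.Icc (0 : ℝ) 1) :
    ∃ f : ℝ → ℝ, (∀ w, HasDerivAt f (w * f w + h w - ∫ t, h t ∂(gaussianReal 0 1)) w) ∧
      ∀ w, |f w| ≤ 1.26 := by
  set c := ∫ t, h t ∂(gaussianReal 0 1) with hcdef
  have hint : Integrable h (gaussianReal 0 1) := by
    refine Integrable.of_bound hc.aestronglyMeasurable 1 (Filter.Eventually.of_forall fun w => ?_)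
    rw [Real.norm_eq_abs, abs_of_nonneg (h01 w).1]
    exact (h01 w).2
  have hc0 : 0 ≤ c := integral_nonneg fun w => (h01 w).1
  have hc1 : c ≤ 1 := by
    have := integral_mono hint (integrable_const (1 : ℝ)) fun w => (h01 w).2
    simpa using this
  set ψ : ℝ → ℝ := fun t => (h t - c) * Real.exp (-(1 / 2) * t ^ 2) with hψ
  have hψc : Continuous ψ := by fun_prop
  have hψle : ∀ t, ‖ψ t‖ ≤ Real.exp (-(1 / 2) * t ^ 2) := by
    intro t
    rw [hψ, Real.norm_eq_abs, abs_mul, abs_of_pos (Real.exp_pos _)]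
    refine mul_le_of_le_one_left (Real.exp_pos _).le ?_
    rw [abs_le]
    constructor <;> linarith [(h01 t).1, (h01 t).2]
  have hψint : Integrable ψ :=
    integrable_exp_neg_half_sq.mono' hψc.aestronglyMeasurable (Filter.Eventually.of_forall hψle)
  have hψ0 : ∫ t, ψ t = 0 := by
    have h1 := integral_gaussianReal_zero_one fun t => h t - c
    rw [integral_sub hint (integrable_const c)] at h1
    simp only [integral_const, probReal_univ, one_smul, ← hcdef, sub_self] at h1
    have h2 : (√(2 * Real.pi))⁻¹ ≠ 0 := inv_ne_zero (Real.sqrt_ne_zero'.2 (by positivity))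
    exact (mul_eq_zero.1 h1.symm).resolve_left h2
  set F : ℝ → ℝ := fun w => (∫ t in Set.Iic (0 : ℝ), ψ t) + ∫ t in (0 : ℝ)..w, ψ t with hF
  have hFd : ∀ w, HasDerivAt F (ψ w) w := fun w =>
    (intervalIntegral.integral_hasDerivAt_right (hψc.intervalIntegrable _ _)
      hψc.stronglyMeasurable.stronglyMeasurableAtFilter hψc.continuousAt).const_add _
  have hFI : ∀ w, F w = ∫ t in Set.Iic w, ψ t := fun w => by
    rw [hF]
    simp only
    rw [← intervalIntegral.integral_Iic_sub_Iic hψint.integrableOn hψint.integrableOn]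
    ring
  have hexp : ∀ w : ℝ, Real.exp (1 / 2 * w ^ 2) * Real.exp (-(1 / 2) * w ^ 2) = 1 := fun w => by
    rw [← Real.exp_add, ← Real.exp_zero]
    congr 1
    ring
  have hFb : ∀ w, |F w| ≤ 1.26 * Real.exp (-(1 / 2) * w ^ 2) := by
    intro w
    rw [hFI]
    rcases le_total w 0 with hw | hw
    · refine le_trans ?_ (integral_Iic_exp_neg_half_sq_le hw)
      exact norm_integral_le_of_norm_le integrable_exp_neg_half_sq.integrableOn
        (Filter.Eventually.of_forall hψle)
    · -- On the right half-line the total integral of `ψ` is used, which vanishes.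
      have h1 : ∫ t in Set.Iic w, ψ t = -∫ t in Set.Ioi w, ψ t := by
        have := integral_add_compl (measurableSet_Iic (a := w)) hψint
        rw [hψ0, Set.compl_Iic] at this
        linarith
      rw [h1, abs_neg]
      refine le_trans ?_ (integral_Ioi_exp_neg_half_sq_le hw)
      exact norm_integral_le_of_norm_le integrable_exp_neg_half_sq.integrableOn
        (Filter.Eventually.of_forall hψle)
  refine ⟨fun w => Real.exp (1 / 2 * w ^ 2) * F w, fun w => ?_, fun w => ?_⟩
  · have h1 : HasDerivAt (fun w : ℝ => Real.exp (1 / 2 * w ^ 2))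
        (Real.exp (1 / 2 * w ^ 2) * (1 / 2 * (2 * w))) w := by
      have := ((hasDerivAt_pow 2 w).const_mul (1 / 2 : ℝ)).exp
      simpa using this
    refine (h1.mul (hFd w)).congr_deriv ?_
    have h2 : Real.exp (1 / 2 * w ^ 2) * ψ w = h w - c := by
      rw [hψ]
      simp only
      rw [mul_left_comm, hexp, mul_one]
    rw [h2]
    ring
  · rw [abs_mul, abs_of_pos (Real.exp_pos _)]
    calc Real.exp (1 / 2 * w ^ 2) * |F w|
        ≤ Real.exp (1 / 2 * w ^ 2) * (1.26 * Real.exp (-(1 / 2) * w ^ 2)) :=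
          mul_le_mul_of_nonneg_left (hFb w) (Real.exp_pos _).le
      _ = 1.26 * (Real.exp (1 / 2 * w ^ 2) * Real.exp (-(1 / 2) * w ^ 2)) := by ring
      _ = 1.26 := by rw [hexp, mul_one]

/-- The properties of the solution `f` of the Stein equation `f' - w f = h - ∫ h dγ` that are used
for a smoothed indicator `h` of the half-line `(-∞, z]` with transition on `[z, z + 2 ε]`; here
`g = f'` and `g' = f''`. -/
structure IsSteinSolution (z ε : ℝ) (h f g g' : ℝ → ℝ) : Prop where
  continuous_h : Continuous h
  h_mem : ∀ w, h w ∈ Set.Icc (0 : ℝ) 1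
  h_left : ∀ w, w ≤ z → h w = 1
  h_right : ∀ w, z + 2 * ε ≤ w → h w = 0
  hasDerivAt_f : ∀ w, HasDerivAt f (g w) w
  hasDerivAt_g : ∀ w, HasDerivAt g (g' w) w
  stein : ∀ w, g w - w * f w = h w - ∫ t, h t ∂(gaussianReal 0 1)
  abs_f_le : ∀ w, |f w| ≤ 1.26
  abs_g_le : ∀ w, |g w| ≤ 1
  abs_g'_le : ∀ w, |g' w| ≤ 2 * (1 / ε + 1.26)
  abs_g'_le_local : ∀ w, |g' w| ≤ 1.26 + |w| + 1 / ε * (Set.Ioo z (z + 2 * ε)).indicator 1 w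

/-- Existence of the solution. The bound of `f'` is the maximum principle applied to the Stein
equation, and the bound of `f''` is the same principle applied to the differentiated equation, whose
bounded solution is `f'`. -/
theorem exists_isSteinSolution (z : ℝ) {ε : ℝ} (hε : 0 < ε) :
    ∃ h f g g' : ℝ → ℝ, IsSteinSolution z ε h f g g' := by
  set h : ℝ → ℝ := fun w => smoothStep ((w - z) / ε) with hh
  set p : ℝ → ℝ := fun w => smoothStepDeriv ((w - z) / ε) * (1 / ε) with hp
  have hhd : ∀ w, HasDerivAt h (p w) w := fun w =>
    (hasDerivAt_smoothStep _).comp w (((hasDerivAt_id w).sub_const z).div_const ε)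
  have hcont : Continuous h := continuous_iff_continuousAt.2 fun w => (hhd w).continuousAt
  have h01 : ∀ w, h w ∈ Set.Icc (0 : ℝ) 1 := fun w => smoothStep_mem _
  obtain ⟨f, hf, hfb⟩ := exists_stein_solution hcont h01
  set c := ∫ t, h t ∂(gaussianReal 0 1) with hcdef
  have hc0 : 0 ≤ c := integral_nonneg fun w => (h01 w).1
  have hc1 : c ≤ 1 := by
    have hint : Integrable h (gaussianReal 0 1) := by
      refine Integrable.of_bound hcont.aestronglyMeasurable 1
        (Filter.Eventually.of_forall fun w => ?_)
      rw [Real.norm_eq_abs, abs_of_nonneg (h01 w).1]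
      exact (h01 w).2
    have := integral_mono hint (integrable_const (1 : ℝ)) fun w => (h01 w).2
    simpa using this
  set g : ℝ → ℝ := fun w => w * f w + h w - c with hg
  have hgd : ∀ w, HasDerivAt g (f w + w * g w + p w) w := fun w => by
    have := (((hasDerivAt_id w).mul (hf w)).add (hhd w)).sub_const c
    refine this.congr_deriv ?_
    simp only [hg, id_eq]
    ring
  have hg1 : ∀ w, |g w| ≤ 1 := by
    intro w
    have := mul_mem_of_stein (R₁ := c) (R₂ := 1 - c) hf hfb hc0 (by linarith)
      (fun w => ⟨by linarith [(h01 w).1], by linarith [(h01 w).2]⟩) w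
    rw [abs_le]
    simp only [hg]
    constructor <;> linarith [this.1, this.2, (h01 w).1, (h01 w).2]
  have hε' : 0 < 1 / ε := one_div_pos.2 hε
  have hp1 : ∀ w, |p w| ≤ 1 / ε * (Set.Ioo z (z + 2 * ε)).indicator 1 w := by
    intro w
    by_cases hw : w ∈ Set.Ioo z (z + 2 * ε)
    · rw [Set.indicator_of_mem hw, hp, abs_mul, abs_of_pos hε', mul_comm]
      refine mul_le_mul_of_nonneg_left ?_ hε'.le
      have := smoothStepDeriv_mem ((w - z) / ε)
      rw [abs_le]
      exact ⟨this.1, this.2.trans (by norm_num)⟩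
    · have : (w - z) / ε ∉ Set.Ioo (0 : ℝ) 2 := by
        rintro ⟨h1, h2⟩
        rw [lt_div_iff₀ hε] at h1
        rw [div_lt_iff₀ hε] at h2
        exact hw ⟨by linarith, by linarith⟩
      rw [Set.indicator_of_notMem hw, hp]
      simp [smoothStepDeriv_eq_zero this]
  have hp2 : ∀ w, |p w| ≤ 1 / ε := fun w => (hp1 w).trans <|
    mul_le_of_le_one_right hε'.le (Set.indicator_le_self' (by simp) w)
  refine ⟨h, f, g, fun w => f w + w * g w + p w, hcont, h01, ?_, ?_, hf, hgd, ?_, hfb, hg1, ?_, ?_⟩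
  · intro w hw
    exact smoothStep_of_nonpos (div_nonpos_of_nonpos_of_nonneg (by linarith) hε.le)
  · intro w hw
    exact smoothStep_of_two_le ((le_div_iff₀ hε).2 (by linarith))
  · intro w
    simp only [hg]
    ring
  · -- Differentiating, `g` solves the Stein equation with right-hand side `f + h'`.
    intro w
    have h1 : ∀ w, |f w + p w| ≤ 1 / ε + 1.26 := fun w =>
      (abs_add_le _ _).trans (by linarith [hfb w, hp2 w])
    have hR : (0 : ℝ) ≤ 1 / ε + 1.26 := by linarith
    have h2 := mul_mem_of_stein (R₁ := 1 / ε + 1.26) (R₂ := 1 / ε + 1.26) hgd hg1 hR hR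
      (fun w => by
        have := abs_le.1 (h1 w)
        constructor <;> linarith [this.1, this.2]) w
    have h3 := abs_le.1 (h1 w)
    rw [abs_le]
    constructor <;> linarith [h2.1, h2.2, h3.1, h3.2]
  · intro w
    calc |f w + w * g w + p w| ≤ |f w| + |w * g w| + |p w| := abs_add_three _ _ _
      _ ≤ _ := by
        have : |w * g w| ≤ |w| := by
          rw [abs_mul]
          exact mul_le_of_le_one_right (abs_nonneg _) (hg1 w)
        linarith [hfb w, hp1 w]

/-- Second-order Taylor formula with Lagrange remainder, expanded backwards from `w`. -/
theorem exists_taylor_two {f g g' : ℝ → ℝ} (hf : ∀ w, HasDerivAt f (g w) w)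
    (hg : ∀ w, HasDerivAt g (g' w) w) (w y : ℝ) :
    ∃ s ∈ Set.Icc (0 : ℝ) 1, f w - f (w - y) - y * g w = -(y ^ 2 / 2 * g' (w - s * y)) := by
  have hlin : ∀ s : ℝ, HasDerivAt (fun s : ℝ => w - s * y) (-y) s := fun s => by
    simpa using ((hasDerivAt_id s).mul_const y).const_sub w
  have hq : ∀ s : ℝ, HasDerivAt (fun s : ℝ => f (w - s * y) + s * y * g w)
      (-y * g (w - s * y) + y * g w) s := fun s => by
    have h1 := (hf (w - s * y)).scomp s (hlin s)
    have h2 := ((hasDerivAt_id s).mul_const y).mul_const (g w)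
    exact (h1.add h2).congr_deriv (by simp)
  obtain ⟨s, hs, hs'⟩ := exists_ratio_hasDerivAt_eq_ratio_slope
    (fun s : ℝ => f (w - s * y) + s * y * g w) _ zero_lt_one
    (fun s _ => (hq s).continuousAt.continuousWithinAt) (fun s _ => hq s)
    (fun s : ℝ => s ^ 2) (fun s => 2 * s)
    (by fun_prop) (fun s _ => by simpa using hasDerivAt_pow 2 s)
  have hψ : ∀ s : ℝ, HasDerivAt (fun s : ℝ => g (w - s * y)) (-y * g' (w - s * y)) s := fun s =>
    ((hg (w - s * y)).scomp s (hlin s)).congr_deriv (by simp)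
  obtain ⟨t, ht, ht'⟩ := exists_hasDerivAt_eq_slope (fun s : ℝ => g (w - s * y)) _ hs.1
    (fun s _ => (hψ s).continuousAt.continuousWithinAt) (fun s _ => hψ s)
  refine ⟨t, ⟨ht.1.le, ht.2.le.trans hs.2.le⟩, ?_⟩
  rw [eq_div_iff (by linarith [hs.1])] at ht'
  simp only [one_pow, zero_mul, sub_zero, one_mul, ne_eq, OfNat.ofNat_ne_zero, not_false_eq_true,
    zero_pow, add_zero] at hs' ht'
  have hs0 : s ≠ 0 := hs.1.ne'
  have h3 : (f w - f (w - y) - y * g w) * (2 * s) = -(y ^ 2 / 2 * g' (w - t * y)) * (2 * s) := by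
    linear_combination hs' - y * ht'
  exact mul_right_cancel₀ (mul_ne_zero two_ne_zero hs0) h3

/-- First-order Taylor formula with Lagrange remainder, expanded backwards from `w`. -/
theorem exists_taylor_one {g g' : ℝ → ℝ} (hg : ∀ w, HasDerivAt g (g' w) w) (w y : ℝ) :
    ∃ s ∈ Set.Icc (0 : ℝ) 1, g w - g (w - y) = y * g' (w - s * y) := by
  have hlin : ∀ s : ℝ, HasDerivAt (fun s : ℝ => w - s * y) (-y) s := fun s => by
    simpa using ((hasDerivAt_id s).mul_const y).const_sub w
  have hψ : ∀ s : ℝ, HasDerivAt (fun s : ℝ => g (w - s * y)) (-y * g' (w - s * y)) s := fun s =>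
    ((hg (w - s * y)).scomp s (hlin s)).congr_deriv (by simp)
  obtain ⟨t, ht, ht'⟩ := exists_hasDerivAt_eq_slope (fun s : ℝ => g (w - s * y)) _
    (zero_lt_one' ℝ) (fun s _ => (hψ s).continuousAt.continuousWithinAt) (fun s _ => hψ s)
  refine ⟨t, ⟨ht.1.le, ht.2.le⟩, ?_⟩
  simp only [one_mul, zero_mul, sub_zero, div_one] at ht'
  linarith

theorem gaussianReal_real_Ioc_le {a b : ℝ} (hab : a ≤ b) :
    (gaussianReal 0 1).real (Set.Ioc a b) ≤ 0.4 * (b - a) := by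
  have h1 : ∀ x : ℝ, gaussianPDFReal 0 1 x ≤ 0.4 := by
    intro x
    simp only [gaussianPDFReal, NNReal.coe_one, mul_one, sub_zero]
    have h2 : (2.5 : ℝ) ≤ √(2 * Real.pi) := by
      apply Real.le_sqrt_of_sq_le
      linarith [Real.pi_gt_d2]
    have h3 : (√(2 * Real.pi))⁻¹ ≤ 0.4 := by
      rw [inv_le_comm₀ (by linarith) (by norm_num)]
      linarith
    have h4 : Real.exp (-x ^ 2 / 2) ≤ 1 := Real.exp_le_one_iff.2 (by nlinarith [sq_nonneg x])
    exact (mul_le_of_le_one_right (by positivity) h4).trans h3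
  rw [measureReal_def, gaussianReal_apply _ (by norm_num)]
  refine ENNReal.toReal_le_of_le_ofReal (by nlinarith) ?_
  calc ∫⁻ x in Set.Ioc a b, gaussianPDF 0 1 x ≤ ∫⁻ x in Set.Ioc a b, ENNReal.ofReal 0.4 :=
        lintegral_mono fun x => ENNReal.ofReal_le_ofReal (h1 x)
    _ = ENNReal.ofReal (0.4 * (b - a)) := by
        rw [setLIntegral_const, Real.volume_Ioc, ENNReal.ofReal_mul (by norm_num)]

/-! ### Stein's method for locally dependent variables -/

section LocalDependence

set_option linter.unusedSectionVars false

variable {Ω ι : Type*} [MeasurableSpace Ω] [Fintype ι]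

/-- The centred sum `∑ i, (η i - E[η i])`. -/
noncomputable def centeredSum (η : ι → Ω → ℝ) (μ : Measure Ω) (ω : Ω) : ℝ :=
  ∑ i, (η i ω - ∫ ω', η i ω' ∂μ)

/-- The centred sum after removal of the summands with index in `s`. The removed summands are not
centred, so that the removed part is controlled by the absolute values `|η l|` alone. -/
noncomputable def remoteSum (η : ι → Ω → ℝ) (μ : Measure Ω) (s : Finset ι) (ω : Ω) : ℝ :=
  centeredSum η μ ω - ∑ l ∈ s, η l ω

/-- The square-integrable variables `η i` have dependency neighbourhoods `N i` with at most `D`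
elements, and their sum has variance one. -/
structure IsLocallyDependent (η : ι → Ω → ℝ) (N : ι → Finset ι) (D : ℝ) (μ : Measure Ω) :
    Prop where
  measurable : ∀ i, Measurable (η i)
  memLp : ∀ i, MemLp (η i) 2 μ
  mem_self : ∀ i, i ∈ N i
  mem_symm : ∀ i j, j ∈ N i ↔ i ∈ N j
  card_le : ∀ i, ((N i).card : ℝ) ≤ D
  indep : ∀ s t : Finset ι, (∀ i ∈ s, ∀ j ∈ t, j ∉ N i) →
    IndepFun (fun (ω : Ω) (i : s) => η i ω) (fun (ω : Ω) (j : t) => η j ω) μ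
  integral_sq : ∫ ω, centeredSum η μ ω ^ 2 ∂μ = 1

/-- The majorant `(|η i| + E|η i|) |η j|` of `|(η i - E[η i]) η j|`. -/
noncomputable def pairMajorant (η : ι → Ω → ℝ) (μ : Measure Ω) (i j : ι) (ω : Ω) : ℝ :=
  (|η i ω| + ∫ ω', |η i ω'| ∂μ) * |η j ω|

theorem pairMajorant_nonneg (η : ι → Ω → ℝ) (μ : Measure Ω) (i j : ι) (ω : Ω) :
    0 ≤ pairMajorant η μ i j ω :=
  mul_nonneg (add_nonneg (abs_nonneg _) (integral_nonneg fun _ => abs_nonneg _)) (abs_nonneg _)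

theorem abs_sub_integral_mul_le_pairMajorant (η : ι → Ω → ℝ) (μ : Measure Ω) (i j : ι) (ω : Ω) :
    |η i ω - ∫ ω', η i ω' ∂μ| * |η j ω| ≤ pairMajorant η μ i j ω := by
  refine mul_le_mul_of_nonneg_right ((abs_sub _ _).trans ?_) (abs_nonneg _)
  exact add_le_add_right abs_integral_le_integral_abs _

namespace IsLocallyDependent

variable [DecidableEq ι] {η : ι → Ω → ℝ} {N : ι → Finset ι} {D : ℝ} {μ : Measure Ω}

theorem measurable_centeredSum (h : IsLocallyDependent η N D μ) : Measurable (centeredSum η μ) :=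
  Finset.measurable_fun_sum _ fun i _ => (h.measurable i).sub_const _

theorem measurable_remoteSum (h : IsLocallyDependent η N D μ) (s : Finset ι) :
    Measurable (remoteSum η μ s) :=
  h.measurable_centeredSum.sub (Finset.measurable_fun_sum _ fun i _ => h.measurable i)

/-- A function of `η i, η j, η k` is independent of the sum from which the neighbourhoods of
`i, j, k` have been removed. -/
theorem indepFun_remoteSum (h : IsLocallyDependent η N D μ) {i j k : ι} {s : Finset ι}
    (hi : N i ⊆ s) (hj : N j ⊆ s) (hk : N k ⊆ s) {u : ℝ × ℝ × ℝ → ℝ} (hu : Measurable u) :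
    IndepFun (fun ω => u (η i ω, η j ω, η k ω)) (remoteSum η μ s) μ := by
  have h1 := h.indep {i, j, k} sᶜ (by
    intro a ha b hb hab
    simp only [Finset.mem_insert, Finset.mem_singleton] at ha
    rw [Finset.mem_compl] at hb
    rcases ha with rfl | rfl | rfl
    exacts [hb (hi hab), hb (hj hab), hb (hk hab)])
  have hu' : Measurable fun v : ({i, j, k} : Finset ι) → ℝ =>
      u (v ⟨i, by simp⟩, v ⟨j, by simp⟩, v ⟨k, by simp⟩) :=
    hu.comp ((measurable_pi_apply _).prodMk
      ((measurable_pi_apply _).prodMk (measurable_pi_apply _)))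
  have hv : Measurable fun v : (sᶜ : Finset ι) → ℝ => ∑ l, v l - ∑ i, ∫ ω', η i ω' ∂μ :=
    (Finset.measurable_fun_sum _ fun i _ => measurable_pi_apply i).sub_const _
  have h2 := h1.comp hu' hv
  have h3 : remoteSum η μ s = (fun v => ∑ l, v l - ∑ i, ∫ ω', η i ω' ∂μ) ∘
      fun (ω : Ω) (j : (sᶜ : Finset ι)) => η j ω := by
    funext ω
    simp only [remoteSum, centeredSum, Function.comp_apply, Finset.sum_sub_distrib]
    rw [Finset.sum_coe_sort sᶜ fun l => η l ω, ← Finset.sum_add_sum_compl s fun l => η l ω]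
    ring
  rw [h3]
  exact h2

variable [IsProbabilityMeasure μ]

theorem integrable (h : IsLocallyDependent η N D μ) (i : ι) : Integrable (η i) μ :=
  (h.memLp i).integrable one_le_two

theorem memLp_sub (h : IsLocallyDependent η N D μ) (i : ι) :
    MemLp (fun ω => η i ω - ∫ ω', η i ω' ∂μ) 2 μ :=
  (h.memLp i).sub (memLp_const _)

theorem memLp_centeredSum (h : IsLocallyDependent η N D μ) : MemLp (centeredSum η μ) 2 μ :=
  memLp_finsetSum _ fun i _ => h.memLp_sub i

theorem integral_abs_centeredSum_le (h : IsLocallyDependent η N D μ) :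
    ∫ ω, |centeredSum η μ ω| ∂μ ≤ 1 := by
  have h1 : ∫ ω, |centeredSum η μ ω| ∂μ ≤ ∫ ω, (1 / 2 + centeredSum η μ ω ^ 2 / 2) ∂μ := by
    refine integral_mono (h.memLp_centeredSum.integrable one_le_two).abs
      ((integrable_const _).add (h.memLp_centeredSum.integrable_sq.div_const 2)) fun ω => ?_
    simp only
    nlinarith [sq_nonneg (|centeredSum η μ ω| - 1), sq_abs (centeredSum η μ ω)]
  rw [integral_add (integrable_const _) (h.memLp_centeredSum.integrable_sq.div_const 2),
    integral_div (2 : ℝ) fun ω => centeredSum η μ ω ^ 2, h.integral_sq] at h1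
  simp only [integral_const, probReal_univ, one_smul] at h1
  linarith

theorem integral_sub_mul_comp_remoteSum (h : IsLocallyDependent η N D μ) {i : ι} {s : Finset ι}
    (hi : N i ⊆ s) {u : ℝ → ℝ} (hu : Measurable u) :
    ∫ ω, (η i ω - ∫ ω', η i ω' ∂μ) * u (remoteSum η μ s ω) ∂μ = 0 := by
  have h1 := (h.indepFun_remoteSum hi hi hi (u := fun p => p.1 - ∫ ω', η i ω' ∂μ)
    (measurable_fst.sub_const _)).comp measurable_id hu
  have h2 := h1.integral_fun_mul_eq_mul_integral
    ((h.measurable i).sub_const _).aestronglyMeasurable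
    (hu.comp (h.measurable_remoteSum s)).aestronglyMeasurable
  simp only [Function.comp_apply, id] at h2
  rw [h2, integral_sub (h.integrable i) (integrable_const _)]
  simp

theorem integral_sub_mul_mul_comp_remoteSum (h : IsLocallyDependent η N D μ) {i j : ι}
    {s : Finset ι} (hi : N i ⊆ s) (hj : N j ⊆ s) {u : ℝ → ℝ} (hu : Measurable u) :
    ∫ ω, (η i ω - ∫ ω', η i ω' ∂μ) * η j ω * u (remoteSum η μ s ω) ∂μ =
      (∫ ω, (η i ω - ∫ ω', η i ω' ∂μ) * η j ω ∂μ) * ∫ ω, u (remoteSum η μ s ω) ∂μ := by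
  have h1 := (h.indepFun_remoteSum hi hj hj (u := fun p => (p.1 - ∫ ω', η i ω' ∂μ) * p.2.1)
    (by fun_prop)).comp measurable_id hu
  exact h1.integral_fun_mul_eq_mul_integral
    (((h.measurable i).sub_const _).mul (h.measurable j)).aestronglyMeasurable
    (hu.comp (h.measurable_remoteSum s)).aestronglyMeasurable

theorem integrable_sub_mul (h : IsLocallyDependent η N D μ) (i j : ι) :
    Integrable (fun ω => (η i ω - ∫ ω', η i ω' ∂μ) * η j ω) μ :=
  (h.memLp_sub i).integrable_mul (h.memLp j)

theorem integrable_pairMajorant (h : IsLocallyDependent η N D μ) (i j : ι) :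
    Integrable (pairMajorant η μ i j) μ :=
  ((h.memLp i).abs.add (memLp_const _)).integrable_mul (h.memLp j).abs

/-- The normalization of the variance, in the form in which it enters Stein's identity. -/
theorem sum_integral_sub_mul_sum (h : IsLocallyDependent η N D μ) :
    ∑ i, ∫ ω, (η i ω - ∫ ω', η i ω' ∂μ) * ∑ l ∈ N i, η l ω ∂μ = 1 := by
  rw [← h.integral_sq]
  have h1 : ∀ i, Integrable (fun ω => (η i ω - ∫ ω', η i ω' ∂μ) * centeredSum η μ ω) μ :=
    fun i => (h.memLp_sub i).integrable_mul h.memLp_centeredSum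
  have h2 : ∀ ω, centeredSum η μ ω ^ 2 =
      ∑ i, (η i ω - ∫ ω', η i ω' ∂μ) * centeredSum η μ ω := fun ω => by
    rw [← Finset.sum_mul, sq]
    rfl
  simp_rw [h2]
  rw [integral_finsetSum _ fun i _ => h1 i]
  refine Finset.sum_congr rfl fun i _ => ?_
  have h3 := h.integral_sub_mul_comp_remoteSum (i := i) subset_rfl measurable_id
  have h4 : Integrable (fun ω => (η i ω - ∫ ω', η i ω' ∂μ) * ∑ l ∈ N i, η l ω) μ :=
    (h.memLp_sub i).integrable_mul (memLp_finsetSum _ fun l _ => h.memLp l)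
  rw [← sub_eq_zero, ← integral_sub h4 (h1 i), ← neg_eq_zero, ← integral_neg, ← h3]
  refine integral_congr_ae (Filter.Eventually.of_forall fun ω => ?_)
  simp only [remoteSum, id]
  ring

/-- The error in Stein's identity for a locally dependent sum. Here `Q i j` bounds the
increment of `f'` when the neighbourhoods of `i` and `j` are removed, as well as the corresponding
second-order remainder of `f`. -/
theorem abs_integral_stein_le (h : IsLocallyDependent η N D μ) {f g : ℝ → ℝ} {Cf Cg : ℝ}
    (hf : Measurable f) (hg : Measurable g) (hfb : ∀ w, |f w| ≤ Cf) (hgb : ∀ w, |g w| ≤ Cg)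
    {Q : ι → ι → Ω → ℝ} (hQint : ∀ i j, Integrable (Q i j) μ)
    (hAQ : ∀ i j, Integrable (fun ω => pairMajorant η μ i j ω * Q i j ω) μ)
    (hQ1 : ∀ i, ∀ j ∈ N i, ∀ ω,
      |g (centeredSum η μ ω) - g (remoteSum η μ (N i ∪ N j) ω)| ≤ Q i j ω)
    (hQ2 : ∀ i ω, |f (centeredSum η μ ω) - f (remoteSum η μ (N i) ω)
      - (∑ l ∈ N i, η l ω) * g (centeredSum η μ ω)| ≤ 1 / 2 * ∑ j ∈ N i, |η j ω| * Q i j ω) :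
    |∫ ω, (g (centeredSum η μ ω) - centeredSum η μ ω * f (centeredSum η μ ω)) ∂μ| ≤
      ∑ i, ∑ j ∈ N i, (3 / 2 * ∫ ω, pairMajorant η μ i j ω * Q i j ω ∂μ
        + (∫ ω, pairMajorant η μ i j ω ∂μ) * ∫ ω, Q i j ω ∂μ) := by
  set W := centeredSum η μ with hW
  set ξ : ι → Ω → ℝ := fun i ω => η i ω - ∫ ω', η i ω' ∂μ with hξ
  have hWm : Measurable W := h.measurable_centeredSum
  have hgW : Integrable (fun ω => g (W ω)) μ :=
    Integrable.of_bound (hg.comp hWm).aestronglyMeasurable Cg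
      (Filter.Eventually.of_forall fun ω => hgb _)
  have hgs : ∀ s, Integrable (fun ω => g (remoteSum η μ s ω)) μ := fun s =>
    Integrable.of_bound (hg.comp (h.measurable_remoteSum s)).aestronglyMeasurable Cg
      (Filter.Eventually.of_forall fun ω => hgb _)
  have hξint : ∀ i, Integrable (ξ i) μ := fun i => (h.memLp_sub i).integrable one_le_two
  have hξf : ∀ i, Integrable (fun ω => ξ i ω * f (W ω)) μ := fun i =>
    (hξint i).mul_bdd (c := Cf) (hf.comp hWm).aestronglyMeasurable
      (Filter.Eventually.of_forall fun ω => hfb _)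
  have hξfs : ∀ i s, Integrable (fun ω => ξ i ω * f (remoteSum η μ s ω)) μ := fun i s =>
    (hξint i).mul_bdd (c := Cf) (hf.comp (h.measurable_remoteSum s)).aestronglyMeasurable
      (Filter.Eventually.of_forall fun ω => hfb _)
  have hξη : ∀ i j, Integrable (fun ω => ξ i ω * η j ω) μ := h.integrable_sub_mul
  have hξηg : ∀ i j, Integrable (fun ω => ξ i ω * η j ω * g (W ω)) μ := fun i j =>
    (hξη i j).mul_bdd (c := Cg) (hg.comp hWm).aestronglyMeasurable
      (Filter.Eventually.of_forall fun ω => hgb _)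
  have hξηgs : ∀ i j s, Integrable (fun ω => ξ i ω * η j ω * g (remoteSum η μ s ω)) μ :=
    fun i j s => (hξη i j).mul_bdd (c := Cg) (hg.comp (h.measurable_remoteSum s)).aestronglyMeasurable
      (Filter.Eventually.of_forall fun ω => hgb _)
  -- The left-hand side as a sum over the index of the summand of `W`.
  have hsum : ∫ ω, (g (W ω) - W ω * f (W ω)) ∂μ =
      ∑ i, ((∫ ω, ξ i ω * ∑ l ∈ N i, η l ω ∂μ) * (∫ ω, g (W ω) ∂μ) - ∫ ω, ξ i ω * f (W ω) ∂μ) := by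
    rw [Finset.sum_sub_distrib, ← Finset.sum_mul, h.sum_integral_sub_mul_sum, one_mul,
      ← integral_finsetSum _ fun i _ => hξf i, ← integral_sub hgW (integrable_finsetSum _
        fun i _ => hξf i)]
    refine integral_congr_ae (Filter.Eventually.of_forall fun ω => ?_)
    simp only [← Finset.sum_mul]
    rfl
  rw [hsum]
  refine (Finset.abs_sum_le_sum_abs _ _).trans (Finset.sum_le_sum fun i _ => ?_)
  set Y : Ω → ℝ := fun ω => ∑ l ∈ N i, η l ω with hY
  have hmean : ∫ ω, ξ i ω * f (remoteSum η μ (N i) ω) ∂μ = 0 :=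
    h.integral_sub_mul_comp_remoteSum subset_rfl hf
  have hdecomp : (∫ ω, ξ i ω * Y ω ∂μ) * (∫ ω, g (W ω) ∂μ) - ∫ ω, ξ i ω * f (W ω) ∂μ =
      -(∫ ω, ξ i ω * (f (W ω) - f (remoteSum η μ (N i) ω) - Y ω * g (W ω)) ∂μ) -
      ∑ j ∈ N i, ((∫ ω, ξ i ω * η j ω * (g (W ω) - g (remoteSum η μ (N i ∪ N j) ω)) ∂μ) -
        (∫ ω, ξ i ω * η j ω ∂μ) * ∫ ω, (g (W ω) - g (remoteSum η μ (N i ∪ N j) ω)) ∂μ) := by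
    have e1 : ∫ ω, ξ i ω * (f (W ω) - f (remoteSum η μ (N i) ω) - Y ω * g (W ω)) ∂μ =
        ∫ ω, ξ i ω * f (W ω) ∂μ - ∑ j ∈ N i, ∫ ω, ξ i ω * η j ω * g (W ω) ∂μ := by
      rw [← sub_zero (∫ ω, ξ i ω * f (W ω) ∂μ), ← hmean, ← integral_sub (hξf i) (hξfs i (N i)),
        ← integral_finsetSum _ fun j _ => hξηg i j,
        ← integral_sub (f := fun ω => ξ i ω * f (W ω) - ξ i ω * f (remoteSum η μ (N i) ω))
          ((hξf i).sub (hξfs i (N i))) (integrable_finsetSum _ fun j _ => hξηg i j)]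
      refine integral_congr_ae (Filter.Eventually.of_forall fun ω => ?_)
      simp only [hY, Finset.sum_mul, mul_sub, Finset.mul_sum, mul_assoc]
    have e2 : ∫ ω, ξ i ω * Y ω ∂μ = ∑ j ∈ N i, ∫ ω, ξ i ω * η j ω ∂μ := by
      rw [← integral_finsetSum _ fun j _ => hξη i j]
      refine integral_congr_ae (Filter.Eventually.of_forall fun ω => ?_)
      simp only [hY, Finset.mul_sum]
    have e3 : ∀ j ∈ N i,
        ((∫ ω, ξ i ω * η j ω * (g (W ω) - g (remoteSum η μ (N i ∪ N j) ω)) ∂μ) -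
          (∫ ω, ξ i ω * η j ω ∂μ) * ∫ ω, (g (W ω) - g (remoteSum η μ (N i ∪ N j) ω)) ∂μ) =
        (∫ ω, ξ i ω * η j ω * g (W ω) ∂μ) - (∫ ω, ξ i ω * η j ω ∂μ) * ∫ ω, g (W ω) ∂μ := by
      intro j _
      have e4 := h.integral_sub_mul_mul_comp_remoteSum (i := i) (j := j) (s := N i ∪ N j)
        Finset.subset_union_left Finset.subset_union_right hg
      rw [integral_sub hgW (hgs _)]
      simp only [mul_sub]
      rw [integral_sub (hξηg i j) (hξηgs i j _)]
      simp only [hξ] at e4 ⊢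
      rw [e4]
      ring
    rw [Finset.sum_congr rfl e3, e1, e2, Finset.sum_sub_distrib, Finset.sum_mul]
    ring
  rw [hdecomp]
  have hAle : ∀ j ω, |ξ i ω| * |η j ω| ≤ pairMajorant η μ i j ω := fun j ω =>
    abs_sub_integral_mul_le_pairMajorant η μ i j ω
  have hb1 : |∫ ω, ξ i ω * (f (W ω) - f (remoteSum η μ (N i) ω) - Y ω * g (W ω)) ∂μ| ≤
      ∑ j ∈ N i, 1 / 2 * ∫ ω, pairMajorant η μ i j ω * Q i j ω ∂μ := by
    refine abs_integral_le_integral_abs.trans ?_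
    simp only [← integral_const_mul]
    rw [← integral_finsetSum _ fun j _ => (hAQ i j).const_mul _]
    refine integral_mono_of_nonneg (Filter.Eventually.of_forall fun ω => abs_nonneg _)
      (integrable_finsetSum _ fun j _ => (hAQ i j).const_mul _)
      (Filter.Eventually.of_forall fun ω => ?_)
    simp only [abs_mul]
    calc |ξ i ω| * |f (W ω) - f (remoteSum η μ (N i) ω) - Y ω * g (W ω)|
        ≤ |ξ i ω| * (1 / 2 * ∑ j ∈ N i, |η j ω| * Q i j ω) :=
          mul_le_mul_of_nonneg_left (hQ2 i ω) (abs_nonneg _)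
      _ = ∑ j ∈ N i, 1 / 2 * ((|ξ i ω| * |η j ω|) * Q i j ω) := by
          rw [mul_left_comm, Finset.mul_sum, Finset.mul_sum]
          exact Finset.sum_congr rfl fun j _ => by ring
      _ ≤ _ := Finset.sum_le_sum fun j hj => by
          have : 0 ≤ Q i j ω := (abs_nonneg _).trans (hQ1 i j hj ω)
          have := mul_le_mul_of_nonneg_right (hAle j ω) this
          linarith
  have hb2 : ∀ j ∈ N i, |(∫ ω, ξ i ω * η j ω * (g (W ω) - g (remoteSum η μ (N i ∪ N j) ω)) ∂μ) -
        (∫ ω, ξ i ω * η j ω ∂μ) * ∫ ω, (g (W ω) - g (remoteSum η μ (N i ∪ N j) ω)) ∂μ| ≤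
      (∫ ω, pairMajorant η μ i j ω * Q i j ω ∂μ) +
        (∫ ω, pairMajorant η μ i j ω ∂μ) * ∫ ω, Q i j ω ∂μ := by
    intro j hj
    have c1 : |∫ ω, ξ i ω * η j ω * (g (W ω) - g (remoteSum η μ (N i ∪ N j) ω)) ∂μ| ≤
        ∫ ω, pairMajorant η μ i j ω * Q i j ω ∂μ := by
      refine abs_integral_le_integral_abs.trans (integral_mono_of_nonneg
        (Filter.Eventually.of_forall fun ω => abs_nonneg _) (hAQ i j)
        (Filter.Eventually.of_forall fun ω => ?_))
      simp only [abs_mul]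
      exact mul_le_mul (hAle j ω) (hQ1 i j hj ω) (abs_nonneg _) (pairMajorant_nonneg η μ i j ω)
    have c2 : |∫ ω, ξ i ω * η j ω ∂μ| ≤ ∫ ω, pairMajorant η μ i j ω ∂μ := by
      refine abs_integral_le_integral_abs.trans (integral_mono_of_nonneg
        (Filter.Eventually.of_forall fun ω => abs_nonneg _) (h.integrable_pairMajorant i j)
        (Filter.Eventually.of_forall fun ω => ?_))
      simp only [abs_mul]
      exact hAle j ω
    have c3 : |∫ ω, (g (W ω) - g (remoteSum η μ (N i ∪ N j) ω)) ∂μ| ≤ ∫ ω, Q i j ω ∂μ :=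
      abs_integral_le_integral_abs.trans (integral_mono_of_nonneg
        (Filter.Eventually.of_forall fun ω => abs_nonneg _) (hQint i j)
        (Filter.Eventually.of_forall fun ω => hQ1 i j hj ω))
    refine (abs_sub _ _).trans (add_le_add c1 ?_)
    rw [abs_mul]
    exact mul_le_mul c2 c3 (abs_nonneg _)
      (integral_nonneg fun ω => pairMajorant_nonneg η μ i j ω)
  refine (abs_sub _ _).trans ?_
  rw [abs_neg]
  refine (add_le_add hb1 ((Finset.abs_sum_le_sum_abs _ _).trans
    (Finset.sum_le_sum hb2))).trans (le_of_eq ?_)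
  rw [← Finset.sum_add_distrib]
  exact Finset.sum_congr rfl fun j _ => by ring

end IsLocallyDependent

end LocalDependence

/-! ### The Kolmogorov distance -/

section Kolmogorov

variable {P Q : Measure ℝ} [IsProbabilityMeasure P] [IsProbabilityMeasure Q]

theorem abs_measureReal_sub_le_one (s : Set ℝ) : |P.real s - Q.real s| ≤ 1 := by
  have h1 := measureReal_nonneg (μ := P) (s := s)
  have h2 := measureReal_nonneg (μ := Q) (s := s)
  have h3 : P.real s ≤ 1 := measureReal_le_one
  have h4 : Q.real s ≤ 1 := measureReal_le_one
  rw [abs_le]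
  constructor <;> linarith

theorem abs_sub_le_kolDist (t : ℝ) :
    |P.real (Set.Iic t) - Q.real (Set.Iic t)| ≤ kolDist P Q :=
  le_ciSup (f := fun t : ℝ => |P.real (Set.Iic t) - Q.real (Set.Iic t)|)
    ⟨1, by rintro _ ⟨t, rfl⟩; exact abs_measureReal_sub_le_one _⟩ t

theorem kolDist_le_one : kolDist P Q ≤ 1 :=
  ciSup_le fun _ => abs_measureReal_sub_le_one _

theorem measureReal_Ioc_eq {a b : ℝ} (hab : a ≤ b) :
    P.real (Set.Ioc a b) = P.real (Set.Iic b) - P.real (Set.Iic a) := by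
  have h1 : Set.Ioc a b = Set.Iic b \ Set.Iic a := by
    ext t
    simp [and_comm]
  rw [h1, measureReal_sdiff (Set.Iic_subset_Iic.2 hab) measurableSet_Iic]

theorem measureReal_Ioc_le_add_kolDist {a b : ℝ} (hab : a ≤ b) :
    P.real (Set.Ioc a b) ≤ Q.real (Set.Ioc a b) + 2 * kolDist P Q := by
  rw [measureReal_Ioc_eq hab, measureReal_Ioc_eq hab]
  have h1 := abs_le.1 (abs_sub_le_kolDist (P := P) (Q := Q) a)
  have h2 := abs_le.1 (abs_sub_le_kolDist (P := P) (Q := Q) b)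
  linarith [h1.1, h2.2]

/-- Passage from smoothed indicators to the Kolmogorov distance. -/
theorem abs_measureReal_Iic_sub_gaussian_le {ε B : ℝ} (hε : 0 < ε)
    (H : ∀ z h f g g', IsSteinSolution z ε h f g g' →
      |∫ w, h w ∂P - ∫ w, h w ∂(gaussianReal 0 1)| ≤ B) (t : ℝ) :
    |P.real (Set.Iic t) - (gaussianReal 0 1).real (Set.Iic t)| ≤ 0.8 * ε + B := by
  have key : ∀ (ν : Measure ℝ) [IsProbabilityMeasure ν] (z : ℝ) (h f g g' : ℝ → ℝ),
      IsSteinSolution z ε h f g g' →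
      ν.real (Set.Iic z) ≤ ∫ w, h w ∂ν ∧ ∫ w, h w ∂ν ≤ ν.real (Set.Iic (z + 2 * ε)) := by
    intro ν _ z h f g g' hs
    have hint : Integrable h ν := by
      refine Integrable.of_bound hs.continuous_h.aestronglyMeasurable 1
        (Filter.Eventually.of_forall fun w => ?_)
      rw [Real.norm_eq_abs, abs_of_nonneg (hs.h_mem w).1]
      exact (hs.h_mem w).2
    rw [← integral_indicator_one measurableSet_Iic, ← integral_indicator_one measurableSet_Iic]
    constructor
    · refine integral_mono ((integrable_const 1).indicator measurableSet_Iic) hint fun w => ?_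
      by_cases hw : w ∈ Set.Iic z
      · rw [Set.indicator_of_mem hw, hs.h_left w hw]
        rfl
      · rw [Set.indicator_of_notMem hw]
        exact (hs.h_mem w).1
    · refine integral_mono hint ((integrable_const 1).indicator measurableSet_Iic) fun w => ?_
      by_cases hw : w ∈ Set.Iic (z + 2 * ε)
      · rw [Set.indicator_of_mem hw]
        exact (hs.h_mem w).2
      · rw [Set.indicator_of_notMem hw, hs.h_right w (not_le.1 hw).le]
  have hgap : ∀ z : ℝ, (gaussianReal 0 1).real (Set.Iic (z + 2 * ε)) ≤
      (gaussianReal 0 1).real (Set.Iic z) + 0.8 * ε := fun z => by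
    have h1 : z ≤ z + 2 * ε := by linarith
    have h2 := gaussianReal_real_Ioc_le h1
    rw [measureReal_Ioc_eq h1] at h2
    linarith
  rw [abs_le]
  constructor
  · obtain ⟨h, f, g, g', hs⟩ := exists_isSteinSolution (t - 2 * ε) hε
    have h1 := (key P _ h f g g' hs).2
    have h2 := (key (gaussianReal 0 1) _ h f g g' hs).1
    have h3 := abs_le.1 (H _ h f g g' hs)
    have h4 := hgap (t - 2 * ε)
    rw [sub_add_cancel] at h1 h4
    linarith [h3.1]
  · obtain ⟨h, f, g, g', hs⟩ := exists_isSteinSolution t hε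
    have h1 := (key P _ h f g g' hs).1
    have h2 := (key (gaussianReal 0 1) _ h f g g' hs).2
    have h3 := abs_le.1 (H _ h f g g' hs)
    linarith [h3.2, hgap t]

end Kolmogorov

/-! ### Elementary inequalities for moments -/

theorem mul_mul_rpow_le {a b c p : ℝ} (ha : 0 ≤ a) (hb : 0 ≤ b) (hc : 0 ≤ c) (hp : 2 < p) :
    a * b * c ^ (p - 2) ≤ a ^ p + b ^ p + c ^ p := by
  set M := max a (max b c) with hM
  have haM : a ≤ M := le_max_left _ _
  have hbM : b ≤ M := (le_max_left b c).trans (le_max_right _ _)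
  have hcM : c ≤ M := (le_max_right b c).trans (le_max_right _ _)
  have hM0 : 0 ≤ M := ha.trans haM
  have h1 : a * b * c ^ (p - 2) ≤ M ^ p := by
    have : M ^ p = M * M * M ^ (p - 2) := by
      rw [show p = (p - 2) + 2 by ring, Real.rpow_add_of_nonneg hM0 (by linarith) (by norm_num),
        show (p - 2 + 2 - 2 : ℝ) = p - 2 by ring, Real.rpow_two]
      ring
    rw [this]
    have h2 : c ^ (p - 2) ≤ M ^ (p - 2) := Real.rpow_le_rpow hc hcM (by linarith)
    have h3 : 0 ≤ c ^ (p - 2) := Real.rpow_nonneg hc _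
    gcongr
  have hap := Real.rpow_nonneg ha p
  have hbp := Real.rpow_nonneg hb p
  have hcp := Real.rpow_nonneg hc p
  refine h1.trans ?_
  rcases max_choice a (max b c) with h | h
  · rw [hM, h]
    linarith
  · rcases max_choice b c with h' | h' <;> rw [hM, h, h'] <;> linarith

theorem mul_mul_le_third {a b c : ℝ} (ha : 0 ≤ a) (hb : 0 ≤ b) (hc : 0 ≤ c) :
    a * b * c ≤ 1 / 3 * (a ^ (3 : ℝ) + b ^ (3 : ℝ) + c ^ (3 : ℝ)) := by
  simp only [Real.rpow_ofNat]
  nlinarith [mul_nonneg (add_nonneg (add_nonneg ha hb) hc)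
    (add_nonneg (add_nonneg (sq_nonneg (a - b)) (sq_nonneg (b - c))) (sq_nonneg (a - c)))]

/-- If one of the numbers `y i` exceeds `κ`, then `a b c` is bounded by moments of order `p ≥ 3`,
since the largest of all the numbers exceeds `κ`. -/
theorem mul_mul_le_of_exists_lt {a b c y₁ y₂ y₃ κ p : ℝ} (ha : 0 ≤ a) (hb : 0 ≤ b) (hc : 0 ≤ c)
    (h₁ : 0 ≤ y₁) (h₂ : 0 ≤ y₂) (h₃ : 0 ≤ y₃) (hκ : 0 < κ) (hp : 3 ≤ p)
    (hy : κ < y₁ ∨ κ < y₂ ∨ κ < y₃) :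
    a * b * c ≤ κ ^ (3 - p) * (a ^ p + b ^ p + (c ^ p + y₁ ^ p + y₂ ^ p + y₃ ^ p)) := by
  set S := a ^ p + b ^ p + (c ^ p + y₁ ^ p + y₂ ^ p + y₃ ^ p) with hS
  have hap := Real.rpow_nonneg ha p
  have hbp := Real.rpow_nonneg hb p
  have hcp := Real.rpow_nonneg hc p
  have h1p := Real.rpow_nonneg h₁ p
  have h2p := Real.rpow_nonneg h₂ p
  have h3p := Real.rpow_nonneg h₃ p
  have main : ∀ M : ℝ, a ≤ M → b ≤ M → c ≤ M → κ < M → M ^ p ≤ S →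
      a * b * c ≤ κ ^ (3 - p) * S := by
    intro M haM hbM hcM hκM hMS
    have hM0 : 0 < M := hκ.trans hκM
    calc a * b * c ≤ M * M * M := by gcongr
      _ = M ^ (3 - p) * M ^ p := by
          rw [← Real.rpow_add hM0, sub_add_cancel, Real.rpow_ofNat]
          ring
      _ ≤ κ ^ (3 - p) * S := mul_le_mul
          (Real.rpow_le_rpow_of_nonpos hκ hκM.le (by linarith)) hMS
          (Real.rpow_nonneg hM0.le _) (Real.rpow_nonneg hκ.le _)
  -- `M` is the largest of `a, b, c` and of a number `y > κ`.
  have aux : ∀ y : ℝ, κ < y → y ^ p ≤ y₁ ^ p + y₂ ^ p + y₃ ^ p → a * b * c ≤ κ ^ (3 - p) * S := by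
    intro y hy hyp
    refine main (max (max a b) (max c y)) ?_ ?_ ?_ ?_ ?_
    · exact (le_max_left _ _).trans (le_max_left _ _)
    · exact (le_max_right _ _).trans (le_max_left _ _)
    · exact (le_max_left _ _).trans (le_max_right _ _)
    · exact hy.trans_le ((le_max_right _ _).trans (le_max_right _ _))
    · rcases max_choice (max a b) (max c y) with h | h <;> rw [h]
      · rcases max_choice a b with h | h <;> rw [h] <;> linarith
      · rcases max_choice c y with h | h <;> rw [h] <;> linarith
  rcases hy with h | h | h
  · exact aux y₁ h (by linarith)
  · exact aux y₂ h (by linarith)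
  · exact aux y₃ h (by linarith)

theorem min_one_le_rpow {s θ : ℝ} (hs : 0 ≤ s) (h0 : 0 ≤ θ) (h1 : θ ≤ 1) : min 1 s ≤ s ^ θ := by
  rcases le_total 1 s with h | h
  · rw [min_eq_left h]
    exact Real.one_le_rpow h h0
  · rw [min_eq_right h]
    exact Real.self_le_rpow_of_le_one hs h h1

/-! ### Sums over neighbourhoods -/

section Neighbourhoods

variable {ι : Type*} [Fintype ι] {N : ι → Finset ι} {D : ℝ} {m : ι → ℝ}

theorem sum_nbhd_const_le (hcard : ∀ i, ((N i).card : ℝ) ≤ D) (hm : ∀ i, 0 ≤ m i) :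
    ∑ i, ∑ _j ∈ N i, m i ≤ D * ∑ i, m i := by
  rw [Finset.mul_sum]
  refine Finset.sum_le_sum fun i _ => ?_
  rw [Finset.sum_const, nsmul_eq_mul]
  exact mul_le_mul_of_nonneg_right (hcard i) (hm i)

theorem sum_nbhd_le (hsymm : ∀ i j, j ∈ N i ↔ i ∈ N j) (hcard : ∀ i, ((N i).card : ℝ) ≤ D)
    (hm : ∀ i, 0 ≤ m i) : ∑ i, ∑ j ∈ N i, m j ≤ D * ∑ i, m i := by
  rw [Finset.sum_comm' (t' := Finset.univ) (s' := N) (fun i j => by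
    simp only [Finset.mem_univ, true_and, and_true]
    exact hsymm i j)]
  exact sum_nbhd_const_le hcard hm

theorem sum_nbhd_pair_le (hsymm : ∀ i j, j ∈ N i ↔ i ∈ N j) (hcard : ∀ i, ((N i).card : ℝ) ≤ D)
    (hm : ∀ i, 0 ≤ m i) : ∑ i, ∑ j ∈ N i, (m i + m j) ≤ 2 * D * ∑ i, m i := by
  simp only [Finset.sum_add_distrib]
  linarith [sum_nbhd_const_le hcard hm, sum_nbhd_le hsymm hcard hm]

theorem sum_nbhd_triple_le (hsymm : ∀ i j, j ∈ N i ↔ i ∈ N j) (hcard : ∀ i, ((N i).card : ℝ) ≤ D)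
    (hm : ∀ i, 0 ≤ m i) (hD : 0 ≤ D) :
    ∑ i, ∑ j ∈ N i, (∑ k ∈ N i, (m i + m j + m k) + ∑ k ∈ N j, (m i + m j + m k)) ≤
      6 * D ^ 2 * ∑ i, m i := by
  have hS : ∀ i, 0 ≤ ∑ k ∈ N i, m k := fun i => Finset.sum_nonneg fun k _ => hm k
  have hc : ∀ i (c : ℝ), 0 ≤ c → ((N i).card : ℝ) * c ≤ D * c := fun i c hc =>
    mul_le_mul_of_nonneg_right (hcard i) hc
  have h1 : ∀ i j, ∑ k ∈ N i, (m i + m j + m k) + ∑ k ∈ N j, (m i + m j + m k) ≤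
      2 * D * (m i + m j) + ((∑ k ∈ N i, m k) + ∑ k ∈ N j, m k) := by
    intro i j
    simp only [Finset.sum_add_distrib, Finset.sum_const, nsmul_eq_mul]
    linarith [hc i (m i) (hm i), hc i (m j) (hm j), hc j (m i) (hm i), hc j (m j) (hm j)]
  refine (Finset.sum_le_sum fun i _ => Finset.sum_le_sum fun j _ => h1 i j).trans ?_
  simp only [Finset.sum_add_distrib (s := N _) (f := fun j => 2 * D * (m _ + m j)),
    ← Finset.mul_sum (s := N _), Finset.sum_add_distrib (s := Finset.univ), ← Finset.mul_sum]
  have h2 := sum_nbhd_pair_le hsymm hcard hm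
  have h3 := sum_nbhd_pair_le (m := fun i => ∑ k ∈ N i, m k) hsymm hcard hS
  have h4 := sum_nbhd_le hsymm hcard hm
  nlinarith [mul_le_mul_of_nonneg_left h2 hD, mul_le_mul_of_nonneg_left h4 hD]

end Neighbourhoods

/-! ### Moment bounds for locally dependent variables -/

section Moments

set_option linter.unusedSectionVars false

variable {Ω ι : Type*} [MeasurableSpace Ω]

/-- The sum of the absolute values of the variables with index in `s`. -/
noncomputable def absSum (η : ι → Ω → ℝ) (s : Finset ι) (ω : Ω) : ℝ := ∑ l ∈ s, |η l ω|

theorem absSum_nonneg (η : ι → Ω → ℝ) (s : Finset ι) (ω : Ω) : 0 ≤ absSum η s ω :=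
  Finset.sum_nonneg fun _ _ => abs_nonneg _

theorem abs_sum_le_absSum {η : ι → Ω → ℝ} {s t : Finset ι} (hst : s ⊆ t) (ω : Ω) :
    |∑ l ∈ s, η l ω| ≤ absSum η t ω :=
  (Finset.abs_sum_le_sum_abs _ _).trans
    (Finset.sum_le_sum_of_subset_of_nonneg hst fun _ _ _ => abs_nonneg _)

theorem absSum_union_le [DecidableEq ι] (η : ι → Ω → ℝ) (s t : Finset ι) (ω : Ω) :
    absSum η (s ∪ t) ω ≤ absSum η s ω + absSum η t ω := by
  unfold absSum
  rw [← Finset.sum_union_inter]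
  exact le_add_of_nonneg_right (Finset.sum_nonneg fun _ _ => abs_nonneg _)

theorem absSum_rpow_le (η : ι → Ω → ℝ) {s : Finset ι} {D p : ℝ} (hs : (s.card : ℝ) ≤ D)
    (hp : 1 ≤ p) (ω : Ω) : absSum η s ω ^ p ≤ D ^ (p - 1) * ∑ l ∈ s, |η l ω| ^ p := by
  refine (Real.rpow_sum_le_const_mul_sum_rpow s (fun l => η l ω) hp).trans ?_
  refine mul_le_mul_of_nonneg_right
    (Real.rpow_le_rpow (Nat.cast_nonneg _) hs (by linarith))
    (Finset.sum_nonneg fun _ _ => Real.rpow_nonneg (abs_nonneg _) _)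

namespace IsLocallyDependent

variable [Fintype ι] [DecidableEq ι] {η : ι → Ω → ℝ} {N : ι → Finset ι} {D : ℝ} {μ : Measure Ω}

theorem measurable_absSum (h : IsLocallyDependent η N D μ) (s : Finset ι) :
    Measurable (absSum η s) :=
  Finset.measurable_fun_sum _ fun i _ => (h.measurable i).abs

theorem measurable_pairMajorant (h : IsLocallyDependent η N D μ) (i j : ι) :
    Measurable (pairMajorant η μ i j) :=
  ((h.measurable i).abs.add_const _).mul (h.measurable j).abs

variable [IsProbabilityMeasure μ]

/-- A pointwise bound of `a b q` by moments of order `p` gives a bound for `pairMajorant` times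
`q`, both jointly and after taking the expectation of one factor: in a product of expectations
the pointwise bound is integrated in each variable separately. -/
theorem pairMajorant_mul_le (h : IsLocallyDependent η N D μ) {p K : ℝ}
    (hint : ∀ i, Integrable (fun ω => |η i ω| ^ p) μ) {q v : Ω → ℝ}
    (hqm : Measurable q) (hq0 : ∀ ω, 0 ≤ q ω) (hv : Integrable v μ)
    (hqv : ∀ ω, ∀ a b : ℝ, 0 ≤ a → 0 ≤ b → a * b * q ω ≤ K * (a ^ p + b ^ p + v ω)) (i j : ι) :
    Integrable (fun ω => pairMajorant η μ i j ω * q ω) μ ∧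
    ∫ ω, pairMajorant η μ i j ω * q ω ∂μ ≤
      2 * K * (∫ ω, |η i ω| ^ p ∂μ + ∫ ω, |η j ω| ^ p ∂μ + ∫ ω, v ω ∂μ) ∧
    (∫ ω, pairMajorant η μ i j ω ∂μ) * ∫ ω, q ω ∂μ ≤
      2 * K * (∫ ω, |η i ω| ^ p ∂μ + ∫ ω, |η j ω| ^ p ∂μ + ∫ ω, v ω ∂μ) := by
  set Mi := ∫ ω, |η i ω| ^ p ∂μ with hMi
  set Mj := ∫ ω, |η j ω| ^ p ∂μ with hMj
  have hone : ∀ ω, ∀ b : ℝ, 0 ≤ b → (∫ ω', |η i ω'| ∂μ) * b * q ω ≤ K * (Mi + b ^ p + v ω) := by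
    intro ω b hb
    have h1 : ∫ ω', |η i ω'| * (b * q ω) ∂μ ≤ ∫ ω', K * (|η i ω'| ^ p + (b ^ p + v ω)) ∂μ := by
      refine integral_mono ((h.integrable i).abs.mul_const _)
        (((hint i).add (integrable_const _)).const_mul K) fun ω' => ?_
      simpa only [mul_assoc, add_assoc] using hqv ω |η i ω'| b (abs_nonneg _) hb
    rw [integral_mul_const, integral_const_mul, integral_add (hint i) (integrable_const _)] at h1
    simp only [integral_const, probReal_univ, one_smul] at h1
    linarith
  have hA : ∀ ω ω' : Ω, pairMajorant η μ i j ω' * q ω ≤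
      K * (|η i ω'| ^ p + Mi + 2 * |η j ω'| ^ p + 2 * v ω) := by
    intro ω ω'
    unfold pairMajorant
    have h1 := hqv ω |η i ω'| |η j ω'| (abs_nonneg _) (abs_nonneg _)
    have h2 := hone ω |η j ω'| (abs_nonneg _)
    nlinarith
  have hAint : ∀ ω, Integrable (fun ω' => K * (|η i ω'| ^ p + Mi + 2 * |η j ω'| ^ p + 2 * v ω)) μ :=
    fun ω => ((((hint i).add (integrable_const _)).add ((hint j).const_mul 2)).add
      (integrable_const _)).const_mul K
  have hP : Integrable (fun ω => |η i ω| ^ p + Mi + 2 * |η j ω| ^ p) μ :=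
    ((hint i).add (integrable_const _)).add ((hint j).const_mul 2)
  have hPint : ∫ ω, (|η i ω| ^ p + Mi + 2 * |η j ω| ^ p) ∂μ = 2 * Mi + 2 * Mj := by
    rw [integral_add (f := fun ω => |η i ω| ^ p + Mi) ((hint i).add (integrable_const _))
        ((hint j).const_mul 2), integral_add (hint i) (integrable_const _), integral_const_mul]
    simp only [integral_const, probReal_univ, one_smul]
    ring
  have hbound : Integrable (fun ω => K * (|η i ω| ^ p + Mi + 2 * |η j ω| ^ p + 2 * v ω)) μ :=
    (hP.add (hv.const_mul 2)).const_mul K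
  have hnn : ∀ ω, 0 ≤ pairMajorant η μ i j ω * q ω := fun ω =>
    mul_nonneg (pairMajorant_nonneg η μ i j ω) (hq0 ω)
  refine ⟨hbound.mono' ((h.measurable_pairMajorant i j).mul hqm).aestronglyMeasurable
    (Filter.Eventually.of_forall fun ω => ?_), ?_, ?_⟩
  · rw [Real.norm_eq_abs, abs_of_nonneg (hnn ω)]
    exact hA ω ω
  · have h1 := integral_mono_of_nonneg (Filter.Eventually.of_forall hnn) hbound
      (Filter.Eventually.of_forall fun ω => hA ω ω)
    rw [integral_const_mul, integral_add hP (hv.const_mul 2), hPint, integral_const_mul] at h1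
    linarith
  · have h1 : ∀ ω, (∫ ω', pairMajorant η μ i j ω' ∂μ) * q ω ≤
        K * (2 * Mi + 2 * Mj + 2 * v ω) := fun ω => by
      have h2 := integral_mono ((h.integrable_pairMajorant i j).mul_const (q ω)) (hAint ω)
        fun ω' => hA ω ω'
      rw [integral_mul_const, integral_const_mul, integral_add hP (integrable_const _), hPint] at h2
      simpa only [integral_const, probReal_univ, one_smul] using h2
    have h2 := integral_mono_of_nonneg (Filter.Eventually.of_forall fun ω =>
        mul_nonneg (integral_nonneg fun ω' => pairMajorant_nonneg η μ i j ω') (hq0 ω))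
      (((integrable_const (2 * Mi + 2 * Mj)).add (hv.const_mul 2)).const_mul K)
      (Filter.Eventually.of_forall h1)
    simp only [Pi.add_apply] at h2
    rw [integral_const_mul, integral_const_mul,
      integral_add (integrable_const _) (hv.const_mul 2), integral_const_mul] at h2
    simp only [integral_const, probReal_univ, one_smul] at h2
    linarith

theorem integrable_absSum_rpow (h : IsLocallyDependent η N D μ) {p : ℝ} (hp : 1 ≤ p)
    (hint : ∀ i, Integrable (fun ω => |η i ω| ^ p) μ) (s : Finset ι) :
    Integrable (fun ω => absSum η s ω ^ p) μ := by
  refine ((integrable_finsetSum s fun l _ => hint l).const_mul ((s.card : ℝ) ^ (p - 1))).mono'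
    ((h.measurable_absSum s).pow_const p).aestronglyMeasurable
    (Filter.Eventually.of_forall fun ω => ?_)
  rw [Real.norm_eq_abs, abs_of_nonneg (Real.rpow_nonneg (absSum_nonneg _ _ _) _)]
  exact absSum_rpow_le η le_rfl hp ω

theorem integral_absSum_rpow_le (h : IsLocallyDependent η N D μ) {p : ℝ} (hp : 1 ≤ p)
    (hint : ∀ i, Integrable (fun ω => |η i ω| ^ p) μ) (i : ι) :
    ∫ ω, absSum η (N i) ω ^ p ∂μ ≤ D ^ (p - 1) * ∑ l ∈ N i, ∫ ω, |η l ω| ^ p ∂μ := by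
  rw [← integral_finsetSum _ fun l _ => hint l, ← integral_const_mul]
  exact integral_mono (h.integrable_absSum_rpow hp hint _)
    ((integrable_finsetSum _ fun l _ => hint l).const_mul _)
    fun ω => absSum_rpow_le η (h.card_le i) hp ω

theorem integral_absSum_div_rpow_le (h : IsLocallyDependent η N D μ) {p : ℝ} (hD : 0 < D)
    (hp : 1 ≤ p) (hint : ∀ i, Integrable (fun ω => |η i ω| ^ p) μ) (i : ι) :
    ∫ ω, (absSum η (N i) ω / D) ^ p ∂μ ≤ D⁻¹ * ∑ l ∈ N i, ∫ ω, |η l ω| ^ p ∂μ := by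
  have h1 : ∀ ω, (absSum η (N i) ω / D) ^ p = (D ^ p)⁻¹ * absSum η (N i) ω ^ p := fun ω => by
    rw [Real.div_rpow (absSum_nonneg _ _ _) hD.le, div_eq_inv_mul]
  simp_rw [h1]
  rw [integral_const_mul]
  calc (D ^ p)⁻¹ * ∫ ω, absSum η (N i) ω ^ p ∂μ
      ≤ (D ^ p)⁻¹ * (D ^ (p - 1) * ∑ l ∈ N i, ∫ ω, |η l ω| ^ p ∂μ) :=
        mul_le_mul_of_nonneg_left (h.integral_absSum_rpow_le hp hint i) (by positivity)
    _ = _ := by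
        rw [← mul_assoc, Real.rpow_sub_one hD.ne']
        congr 1
        field_simp

/-- The bound `abs_measureReal_Iic_sub_gaussian_le` for the law of a locally dependent sum. -/
theorem abs_measureReal_Iic_sub_gaussian_le (h : IsLocallyDependent η N D μ) {ε B : ℝ} (hε : 0 < ε)
    (H : ∀ z h f g g', IsSteinSolution z ε h f g g' →
      |∫ ω, (g (centeredSum η μ ω) - centeredSum η μ ω * f (centeredSum η μ ω)) ∂μ| ≤ B) (t : ℝ) :
    |(μ.map (centeredSum η μ)).real (Set.Iic t) - (gaussianReal 0 1).real (Set.Iic t)| ≤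
      0.8 * ε + B := by
  have := Measure.isProbabilityMeasure_map (μ := μ) h.measurable_centeredSum.aemeasurable
  refine UStatistics.abs_measureReal_Iic_sub_gaussian_le hε (fun z u f g g' hs => ?_) t
  rw [integral_map h.measurable_centeredSum.aemeasurable hs.continuous_h.aestronglyMeasurable]
  refine le_of_eq_of_le ?_ (H z u f g g' hs)
  congr 1
  simp_rw [hs.stein]
  have hint : Integrable (fun ω => u (centeredSum η μ ω)) μ := by
    refine Integrable.of_bound (hs.continuous_h.measurable.comp
      h.measurable_centeredSum).aestronglyMeasurable 1 (Filter.Eventually.of_forall fun w => ?_)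
    rw [Real.norm_eq_abs, abs_of_nonneg (hs.h_mem _).1]
    exact (hs.h_mem _).2
  rw [integral_sub hint (integrable_const _)]
  simp

end IsLocallyDependent

end Moments

/-! ### The bound for moments of order between two and three -/

section Bounds

set_option linter.unusedSectionVars false

variable {Ω ι : Type*} [MeasurableSpace Ω]

theorem sum_add_inv_mul_sum_nbhd_le [Fintype ι] {N : ι → Finset ι} {D : ℝ} {m : ι → ℝ}
    (hsymm : ∀ i j, j ∈ N i ↔ i ∈ N j) (hcard : ∀ i, ((N i).card : ℝ) ≤ D)
    (hm : ∀ i, 0 ≤ m i) (hD : 0 < D) :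
    ∑ i, (m i + D⁻¹ * ∑ l ∈ N i, m l) ≤ 2 * ∑ i, m i := by
  rw [Finset.sum_add_distrib, ← Finset.mul_sum]
  have h1 := mul_le_mul_of_nonneg_left (sum_nbhd_le hsymm hcard hm) (inv_nonneg.2 hD.le)
  rw [← mul_assoc, inv_mul_cancel₀ hD.ne', one_mul] at h1
  linarith

theorem abs_sum_sub_mul_sum_le [DecidableEq ι] (η : ι → Ω → ℝ) {s t : Finset ι} (hts : t ⊆ s)
    {r : ℝ} (hr : r ∈ Set.Icc (0 : ℝ) 1) (ω : Ω) :
    |∑ l ∈ s, η l ω - r * ∑ l ∈ t, η l ω| ≤ absSum η s ω := by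
  have h1 := abs_sum_le_absSum (η := η) (subset_refl s) ω
  have h2 := abs_sum_le_absSum (η := η) (Finset.sdiff_subset (s := s) (t := t)) ω
  have h3 : ∑ l ∈ s, η l ω - r * ∑ l ∈ t, η l ω =
      (1 - r) * (∑ l ∈ s, η l ω) + r * ∑ l ∈ s \ t, η l ω := by
    rw [← Finset.sum_sdiff hts]
    ring
  rw [h3]
  refine (abs_add_le _ _).trans ?_
  rw [abs_mul, abs_mul, abs_of_nonneg hr.1, abs_of_nonneg (sub_nonneg.2 hr.2)]
  nlinarith [mul_le_mul_of_nonneg_left h1 (sub_nonneg.2 hr.2), mul_le_mul_of_nonneg_left h2 hr.1]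

namespace IsLocallyDependent

variable [Fintype ι] [DecidableEq ι] {η : ι → Ω → ℝ} {N : ι → Finset ι} {D : ℝ} {μ : Measure Ω}
  [IsProbabilityMeasure μ]

/-- The error in Stein's identity when the indicator is smoothed on the scale `3 x`. The increments
of `f'` are Hölder continuous of order `p - 2`, so that only moments of order `p` enter. -/
theorem abs_integral_stein_le_of_le_three (h : IsLocallyDependent η N D μ) (hD : 0 < D) {p x : ℝ}
    (hp2 : 2 < p) (hp3 : p ≤ 3) (hint : ∀ i, Integrable (fun ω => |η i ω| ^ p) μ) (hx0 : 0 < x)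
    (hx : x ≤ 1 / 8) (hM : D ^ (p - 1) * ∑ i, ∫ ω, |η i ω| ^ p ∂μ ≤ x ^ (p + 1))
    {z : ℝ} {u f g g' : ℝ → ℝ} (hs : IsSteinSolution z (3 * x) u f g g') :
    |∫ ω, (g (centeredSum η μ ω) - centeredSum η μ ω * f (centeredSum η μ ω)) ∂μ| ≤
      80 * x ^ 3 := by
  set R : ℝ := 1 / (3 * x) + 1.26 with hR
  have hR0 : 0 < R := by positivity
  set θ : ℝ := p - 2 with hθ
  have hθ0 : 0 < θ := by linarith
  set C : ℝ := 4 * (2 * D * R) ^ θ with hC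
  have hC0 : 0 ≤ C := by positivity
  set Y : ι → Ω → ℝ := fun i => absSum η (N i) with hY
  have hY0 : ∀ i ω, 0 ≤ Y i ω := fun i ω => absSum_nonneg _ _ _
  set q : ι → ι → Ω → ℝ := fun i j ω => ((Y i ω + Y j ω) / (2 * D)) ^ θ with hq
  set v : ι → ι → Ω → ℝ := fun i j ω => (Y i ω / D) ^ p + (Y j ω / D) ^ p with hv
  set M : ι → ℝ := fun i => ∫ ω, |η i ω| ^ p ∂μ with hMdef
  have hM0 : ∀ i, 0 ≤ M i := fun i => integral_nonneg fun ω => Real.rpow_nonneg (abs_nonneg _) _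
  have hYm : ∀ i, Measurable (Y i) := fun i => h.measurable_absSum _
  have hqm : ∀ i j, Measurable (q i j) := fun i j =>
    (((hYm i).add (hYm j)).div_const _).pow_const _
  have hq0 : ∀ i j ω, 0 ≤ q i j ω := fun i j ω =>
    Real.rpow_nonneg (div_nonneg (add_nonneg (hY0 i ω) (hY0 j ω)) (by positivity)) _
  have hYint : ∀ i, Integrable (fun ω => (Y i ω / D) ^ p) μ := fun i => by
    have h1 := (h.integrable_absSum_rpow (by linarith) hint (N i)).div_const (D ^ p)
    refine h1.congr (Filter.Eventually.of_forall fun ω => ?_)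
    simp only
    rw [Real.div_rpow (hY0 i ω) hD.le]
  have hvint : ∀ i j, Integrable (v i j) μ := fun i j => (hYint i).add (hYint j)
  have hu : ∀ i j ω, ((Y i ω + Y j ω) / (2 * D)) ^ p ≤ v i j ω := by
    intro i j ω
    have a1 : 0 ≤ Y i ω / D := div_nonneg (hY0 i ω) hD.le
    have a2 : 0 ≤ Y j ω / D := div_nonneg (hY0 j ω) hD.le
    have a3 : (Y i ω + Y j ω) / (2 * D) = (Y i ω / D + Y j ω / D) / 2 := by
      field_simp
    rw [a3]
    have b1 := Real.rpow_nonneg a1 p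
    have b2 := Real.rpow_nonneg a2 p
    rcases le_total (Y i ω / D) (Y j ω / D) with hle | hle
    · have := Real.rpow_le_rpow (z := p) (by linarith)
        (show (Y i ω / D + Y j ω / D) / 2 ≤ Y j ω / D by linarith) (by linarith)
      simp only [hv]
      linarith
    · have := Real.rpow_le_rpow (z := p) (by linarith)
        (show (Y i ω / D + Y j ω / D) / 2 ≤ Y i ω / D by linarith) (by linarith)
      simp only [hv]
      linarith
  have hqv : ∀ i j ω, ∀ a b : ℝ, 0 ≤ a → 0 ≤ b →
      a * b * q i j ω ≤ 1 * (a ^ p + b ^ p + v i j ω) := by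
    intro i j ω a b ha hb
    refine (mul_mul_rpow_le ha hb
      (div_nonneg (add_nonneg (hY0 i ω) (hY0 j ω)) (by positivity)) hp2).trans ?_
    linarith [hu i j ω]
  have hpair := fun i j =>
    h.pairMajorant_mul_le hint (hqm i j) (hq0 i j) (hvint i j) (hqv i j) i j
  -- The increments of `f'` are bounded both by `2` and linearly, hence by a power `θ ≤ 1`.
  have hinc : ∀ i j ω (a b : ℝ), |a - b| ≤ Y i ω + Y j ω → |g a - g b| ≤ C / 2 * q i j ω := by
    intro i j ω a b hab
    have hU0 : 0 ≤ Y i ω + Y j ω := add_nonneg (hY0 i ω) (hY0 j ω)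
    have h1 : |g a - g b| ≤ 2 :=
      (abs_sub _ _).trans (by linarith [hs.abs_g_le a, hs.abs_g_le b])
    have h2 : |g a - g b| ≤ 2 * (R * (Y i ω + Y j ω)) := by
      obtain ⟨t, -, ht⟩ := exists_taylor_one hs.hasDerivAt_g a (a - b)
      rw [sub_sub_cancel] at ht
      rw [ht, abs_mul]
      have := mul_le_mul hab (hs.abs_g'_le (a - t * (a - b))) (abs_nonneg _) hU0
      rw [← hR] at this
      linarith
    have h3 := min_one_le_rpow (s := R * (Y i ω + Y j ω)) (by positivity) hθ0.le (by linarith)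
    have h4 : C / 2 * q i j ω = 2 * (R * (Y i ω + Y j ω)) ^ θ := by
      simp only [hC, hq]
      have e : R * (Y i ω + Y j ω) = 2 * D * R * ((Y i ω + Y j ω) / (2 * D)) := by field_simp
      rw [e, Real.mul_rpow (x := 2 * D * R) (by positivity) (div_nonneg hU0 (by positivity))]
      ring
    rw [h4]
    rcases min_choice 1 (R * (Y i ω + Y j ω)) with hm | hm <;> rw [hm] at h3 <;> linarith
  have hmain := h.abs_integral_stein_le (f := f) (g := g) (Q := fun i j ω => C * q i j ω)
    (continuous_iff_continuousAt.2 fun w => (hs.hasDerivAt_f w).continuousAt).measurable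
    (continuous_iff_continuousAt.2 fun w => (hs.hasDerivAt_g w).continuousAt).measurable
    hs.abs_f_le hs.abs_g_le
    (fun i j => by
      refine (((integrable_const (1 : ℝ)).add (hvint i j)).mono' (hqm i j).aestronglyMeasurable
        (Filter.Eventually.of_forall fun ω => ?_)).const_mul C
      have hc0 : 0 ≤ (Y i ω + Y j ω) / (2 * D) :=
        div_nonneg (add_nonneg (hY0 i ω) (hY0 j ω)) (by positivity)
      rw [Real.norm_eq_abs, abs_of_nonneg (hq0 i j ω)]
      have hv0 : 0 ≤ v i j ω := (Real.rpow_nonneg hc0 p).trans (hu i j ω)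
      simp only [Pi.add_apply]
      rcases le_total ((Y i ω + Y j ω) / (2 * D)) 1 with hc | hc
      · have := Real.rpow_le_one hc0 hc hθ0.le
        simp only [hq]
        linarith
      · have := Real.rpow_le_rpow_of_exponent_le hc (show θ ≤ p by linarith)
        simp only [hq]
        linarith [hu i j ω])
    (fun i j => by
      refine ((hpair i j).1.const_mul C).congr (Filter.Eventually.of_forall fun ω => ?_)
      simp only
      ring)
    (fun i j _ ω => by
      refine (hinc i j ω _ _ ?_).trans (by linarith [mul_nonneg hC0 (hq0 i j ω)])
      rw [remoteSum, sub_sub_cancel]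
      exact (abs_sum_le_absSum subset_rfl ω).trans (absSum_union_le η _ _ ω))
    (fun i ω => by
      obtain ⟨t, ht, ht'⟩ := exists_taylor_one hs.hasDerivAt_f (centeredSum η μ ω)
        (∑ l ∈ N i, η l ω)
      have e : 1 / 2 * ∑ j ∈ N i, |η j ω| * (C * q i j ω) =
          ∑ j ∈ N i, |η j ω| * (C / 2 * q i j ω) := by
        rw [Finset.mul_sum]
        exact Finset.sum_congr rfl fun j _ => by ring
      rw [remoteSum, ht', ← mul_sub, abs_mul, e]
      refine (mul_le_mul_of_nonneg_right (Finset.abs_sum_le_sum_abs _ _) (abs_nonneg _)).trans ?_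
      rw [Finset.sum_mul]
      refine Finset.sum_le_sum fun j _ => mul_le_mul_of_nonneg_left ?_ (abs_nonneg _)
      have h1 : |g (centeredSum η μ ω - t * ∑ l ∈ N i, η l ω) - g (centeredSum η μ ω)| ≤
          C / 2 * q i j ω := by
        refine hinc i j ω _ _ ?_
        rw [sub_sub_cancel_left, abs_neg, abs_mul, abs_of_nonneg ht.1]
        have := abs_sum_le_absSum (η := η) (subset_refl (N i)) ω
        have h3 := mul_le_mul ht.2 this (abs_nonneg _) zero_le_one
        rw [one_mul] at h3
        refine h3.trans (le_add_of_nonneg_right (hY0 j ω))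
      exact h1)
  refine hmain.trans ?_
  set m : ι → ℝ := fun i => M i + D⁻¹ * ∑ l ∈ N i, M l with hm
  have hm0 : ∀ i, 0 ≤ m i := fun i => add_nonneg (hM0 i)
    (mul_nonneg (inv_nonneg.2 hD.le) (Finset.sum_nonneg fun l _ => hM0 l))
  have hvle : ∀ i j, ∫ ω, v i j ω ∂μ ≤ D⁻¹ * ∑ l ∈ N i, M l + D⁻¹ * ∑ l ∈ N j, M l := by
    intro i j
    simp only [hv]
    rw [integral_add (hYint i) (hYint j)]
    exact add_le_add (h.integral_absSum_div_rpow_le hD (by linarith) hint i)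
      (h.integral_absSum_div_rpow_le hD (by linarith) hint j)
  calc ∑ i, ∑ j ∈ N i, (3 / 2 * ∫ ω, pairMajorant η μ i j ω * (C * q i j ω) ∂μ
        + (∫ ω, pairMajorant η μ i j ω ∂μ) * ∫ ω, C * q i j ω ∂μ)
      ≤ ∑ i, ∑ j ∈ N i, 5 * C * (m i + m j) := by
        refine Finset.sum_le_sum fun i _ => Finset.sum_le_sum fun j _ => ?_
        have h1 := mul_le_mul_of_nonneg_left (hpair i j).2.1 hC0
        have h2 := mul_le_mul_of_nonneg_left (hpair i j).2.2 hC0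
        have h3 := mul_le_mul_of_nonneg_left (hvle i j) hC0
        simp_rw [mul_left_comm _ C]
        rw [integral_const_mul, integral_const_mul]
        simp only [hm]
        linarith
    _ = 5 * C * ∑ i, ∑ j ∈ N i, (m i + m j) := by
        simp only [Finset.mul_sum]
    _ ≤ 5 * C * (2 * D * (2 * ∑ i, M i)) := by
        refine mul_le_mul_of_nonneg_left ?_ (by positivity)
        refine (sum_nbhd_pair_le h.mem_symm h.card_le hm0).trans ?_
        exact mul_le_mul_of_nonneg_left
          (sum_add_inv_mul_sum_nbhd_le h.mem_symm h.card_le hM0 hD) (by positivity)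
    _ = 80 * (2 * R) ^ θ * (D ^ (p - 1) * ∑ i, M i) := by
        simp only [hC]
        rw [show 2 * D * R = 2 * R * D by ring, Real.mul_rpow (by positivity) hD.le,
          show p - 1 = θ + 1 by rw [hθ]; ring, Real.rpow_add_one hD.ne']
        ring
    _ ≤ 80 * (2 * R) ^ θ * x ^ (p + 1) := mul_le_mul_of_nonneg_left hM (by positivity)
    _ = 80 * (2 * R * x) ^ θ * x ^ 3 := by
        rw [show p + 1 = θ + 3 by rw [hθ]; ring, Real.rpow_add hx0, Real.mul_rpow _ hx0.le,
          Real.rpow_ofNat]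
        · ring
        · positivity
    _ ≤ 80 * 1 * x ^ 3 := by
        have h1 : 2 * R * x ≤ 1 := by
          have : 2 * R * x = 2 / 3 + 2.52 * x := by
            rw [hR]
            field_simp
            ring
          rw [this]
          linarith
        have := Real.rpow_le_one (by positivity) h1 hθ0.le
        gcongr
    _ = 80 * x ^ 3 := by ring

/-- The Kolmogorov bound for moments of order `p ∈ (2, 3]`. -/
theorem kolDist_le_of_le_three (h : IsLocallyDependent η N D μ) (hD : 0 < D) {p x : ℝ}
    (hp2 : 2 < p) (hp3 : p ≤ 3) (hint : ∀ i, Integrable (fun ω => |η i ω| ^ p) μ) (hx0 : 0 < x)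
    (hx : x ≤ 1 / 8) (hM : D ^ (p - 1) * ∑ i, ∫ ω, |η i ω| ^ p ∂μ ≤ x ^ (p + 1)) :
    kolDist (μ.map (centeredSum η μ)) (gaussianReal 0 1) ≤ 4 * x := by
  refine ciSup_le fun t => ?_
  refine (h.abs_measureReal_Iic_sub_gaussian_le (ε := 3 * x) (by positivity)
    (fun z u f g g' hs =>
      h.abs_integral_stein_le_of_le_three hD hp2 hp3 hint hx0 hx hM hs) t).trans ?_
  have h1 : x ^ 3 ≤ x * (1 / 64) := by
    rw [show x ^ 3 = x * (x * x) by ring]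
    exact mul_le_mul_of_nonneg_left (by nlinarith) hx0.le
  linarith

end IsLocallyDependent

end Bounds

/-! ### The bound for moments of order at least three -/

section ThirdMoment

set_option linter.unusedSectionVars false

/-- A bound for `|f''|` on an interval of radius `r` about `w`, where `f` solves the Stein
equation for a smoothed indicator with transition on `[z, z + 2 ε]`. -/
noncomputable def localBound (z ε r w : ℝ) : ℝ :=
  1.26 + |w| + r + 1 / ε * (Set.Ioc (z - r) (z + 2 * ε + r)).indicator 1 w

theorem measurable_localBound (z ε r : ℝ) : Measurable (localBound z ε r) :=
  ((measurable_const.add measurable_abs).add measurable_const).add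
    ((measurable_one.indicator measurableSet_Ioc).const_mul _)

theorem localBound_nonneg {z ε r : ℝ} (hε : 0 < ε) (hr : 0 ≤ r) (w : ℝ) :
    0 ≤ localBound z ε r w := by
  have h1 : 0 ≤ (Set.Ioc (z - r) (z + 2 * ε + r)).indicator (1 : ℝ → ℝ) w :=
    Set.indicator_nonneg (fun _ _ => zero_le_one) w
  unfold localBound
  positivity

theorem IsSteinSolution.abs_g'_le_localBound {z ε r : ℝ} {u f g g' : ℝ → ℝ}
    (hs : IsSteinSolution z ε u f g g') (hε : 0 < ε) {v w : ℝ} (hvw : |v - w| ≤ r) :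
    |g' v| ≤ localBound z ε r w := by
  refine (hs.abs_g'_le_local v).trans ?_
  unfold localBound
  have h1 : |v| ≤ |w| + r := by
    have := abs_add_le w (v - w)
    rw [add_sub_cancel] at this
    linarith
  have h2 : (Set.Ioo z (z + 2 * ε)).indicator (1 : ℝ → ℝ) v ≤
      (Set.Ioc (z - r) (z + 2 * ε + r)).indicator (1 : ℝ → ℝ) w := by
    by_cases hv : v ∈ Set.Ioo z (z + 2 * ε)
    · have hw : w ∈ Set.Ioc (z - r) (z + 2 * ε + r) := by
        have := abs_le.1 hvw
        exact ⟨by linarith [hv.1, this.2], by linarith [hv.2, this.1]⟩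
      rw [Set.indicator_of_mem hv, Set.indicator_of_mem hw]
      rfl
    · rw [Set.indicator_of_notMem hv]
      exact Set.indicator_nonneg (fun _ _ => zero_le_one) w
  have h3 := mul_le_mul_of_nonneg_left h2 (one_div_pos.2 hε).le
  linarith

variable {Ω ι : Type*} [MeasurableSpace Ω]

theorem integral_add_three {μ : Measure Ω} {a b c : Ω → ℝ} (ha : Integrable a μ)
    (hb : Integrable b μ) (hc : Integrable c μ) :
    ∫ ω, (a ω + b ω + c ω) ∂μ = ∫ ω, a ω ∂μ + ∫ ω, b ω ∂μ + ∫ ω, c ω ∂μ := by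
  rw [integral_add (f := fun ω => a ω + b ω) (ha.add hb) hc, integral_add ha hb]

namespace IsLocallyDependent

variable [Fintype ι] [DecidableEq ι] {η : ι → Ω → ℝ} {N : ι → Finset ι} {D : ℝ} {μ : Measure Ω}
  [IsProbabilityMeasure μ]

theorem abs_centeredSum_sub_remoteSum_le (i j k : ι) (ω : Ω) :
    |centeredSum η μ ω - remoteSum η μ (N i ∪ N j ∪ N k) ω| ≤
      absSum η (N i) ω + absSum η (N j) ω + absSum η (N k) ω := by
  rw [remoteSum, sub_sub_cancel]
  refine (abs_sum_le_absSum subset_rfl ω).trans ((absSum_union_le η _ _ ω).trans ?_)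
  linarith [absSum_union_le η (N i) (N j) ω]

theorem integral_absSum_rpow_le_of_le (h : IsLocallyDependent η N D μ) (hD : 0 < D) {p x : ℝ}
    (hp : 1 ≤ p) (hint : ∀ i, Integrable (fun ω => |η i ω| ^ p) μ)
    (hM : D ^ (p - 1) * ∑ i, ∫ ω, |η i ω| ^ p ∂μ ≤ x ^ (p + 1)) (i : ι) :
    ∫ ω, absSum η (N i) ω ^ p ∂μ ≤ x ^ (p + 1) := by
  refine (h.integral_absSum_rpow_le hp hint i).trans (le_trans ?_ hM)
  refine mul_le_mul_of_nonneg_left ?_ (Real.rpow_nonneg hD.le _)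
  exact Finset.sum_le_sum_of_subset_of_nonneg (Finset.subset_univ _) fun l _ _ =>
    integral_nonneg fun ω => Real.rpow_nonneg (abs_nonneg _) _

theorem integrable_absSum (h : IsLocallyDependent η N D μ) (s : Finset ι) :
    Integrable (absSum η s) μ :=
  integrable_finsetSum _ fun l _ => (h.integrable l).abs

/-- The first moment of a neighbourhood sum is bounded by truncation at the level `x`: below `x` it
contributes at most `x`, and above `x` it is dominated by its `p`-th power. -/
theorem integral_absSum_le (h : IsLocallyDependent η N D μ) (hD : 0 < D) {p x : ℝ}
    (hp : 1 ≤ p) (hint : ∀ i, Integrable (fun ω => |η i ω| ^ p) μ) (hx : 0 < x)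
    (hM : D ^ (p - 1) * ∑ i, ∫ ω, |η i ω| ^ p ∂μ ≤ x ^ (p + 1)) (i : ι) :
    ∫ ω, absSum η (N i) ω ∂μ ≤ x + x ^ 2 := by
  have h1 : ∀ ω, absSum η (N i) ω ≤ x + x ^ (1 - p) * absSum η (N i) ω ^ p := by
    intro ω
    have h0 := absSum_nonneg η (N i) ω
    rcases le_or_gt (absSum η (N i) ω) x with hle | hgt
    · have : 0 ≤ x ^ (1 - p) * absSum η (N i) ω ^ p :=
        mul_nonneg (Real.rpow_nonneg hx.le _) (Real.rpow_nonneg h0 _)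
      linarith
    · have hpos := hx.trans hgt
      have h2 : absSum η (N i) ω = absSum η (N i) ω ^ (1 - p) * absSum η (N i) ω ^ p := by
        rw [← Real.rpow_add hpos, sub_add_cancel, Real.rpow_one]
      have h3 : absSum η (N i) ω ^ (1 - p) ≤ x ^ (1 - p) :=
        Real.rpow_le_rpow_of_nonpos hx hgt.le (by linarith)
      have h4 := mul_le_mul_of_nonneg_right h3 (Real.rpow_nonneg h0 p)
      linarith
  have hi := h.integrable_absSum_rpow hp hint (N i)
  have h2 := integral_mono (h.integrable_absSum (N i))
    ((integrable_const x).add (hi.const_mul (x ^ (1 - p)))) h1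
  simp only [Pi.add_apply] at h2
  rw [integral_add (integrable_const x) (hi.const_mul _), integral_const_mul] at h2
  simp only [integral_const, probReal_univ, one_smul] at h2
  refine h2.trans (add_le_add_right ?_ x)
  refine (mul_le_mul_of_nonneg_left (h.integral_absSum_rpow_le_of_le hD hp hint hM i)
    (Real.rpow_nonneg hx.le _)).trans (le_of_eq ?_)
  rw [← Real.rpow_add hx, show (1 - p) + (p + 1) = (2 : ℝ) by ring, Real.rpow_ofNat]

/-- Concentration of the remaining sum: it lies in a short interval with a probability controlled
by the length of the interval and by the Kolmogorov distance that is to be bounded. -/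
theorem integral_localBound_le (h : IsLocallyDependent η N D μ) (hD : 0 < D) {p x : ℝ}
    (hp : 1 ≤ p) (hint : ∀ i, Integrable (fun ω => |η i ω| ^ p) μ) (hx : 0 < x)
    (hM : D ^ (p - 1) * ∑ i, ∫ ω, |η i ω| ^ p ∂μ ≤ x ^ (p + 1)) {ε : ℝ} (hε : 0 < ε) (z : ℝ)
    (i j k : ι) :
    Integrable (fun ω => localBound z ε (3 * x) (remoteSum η μ (N i ∪ N j ∪ N k) ω)) μ ∧
    ∫ ω, localBound z ε (3 * x) (remoteSum η μ (N i ∪ N j ∪ N k) ω) ∂μ ≤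
      3.06 + 6 * x + 3 * x ^ 2 +
        1 / ε * (7.8 * x + 2 * kolDist (μ.map (centeredSum η μ)) (gaussianReal 0 1)) := by
  set W := centeredSum η μ with hW
  set W' := remoteSum η μ (N i ∪ N j ∪ N k) with hW'
  set Y : ι → Ω → ℝ := fun i => absSum η (N i) with hY
  set κ := kolDist (μ.map W) (gaussianReal 0 1) with hκ
  have hY0 : ∀ i ω, 0 ≤ Y i ω := fun i ω => absSum_nonneg _ _ _
  have hWm : Measurable W := h.measurable_centeredSum
  have hW'm : Measurable W' := h.measurable_remoteSum _
  have hdist : ∀ ω, |W ω - W' ω| ≤ Y i ω + Y j ω + Y k ω :=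
    abs_centeredSum_sub_remoteSum_le i j k
  have hWint : Integrable W μ := h.memLp_centeredSum.integrable one_le_two
  have hYint : ∀ i, Integrable (Y i) μ := fun i => h.integrable_absSum _
  have hYp : ∀ i, Integrable (fun ω => Y i ω ^ p) μ := fun i =>
    h.integrable_absSum_rpow hp hint _
  have hW'int : Integrable W' μ :=
    hWint.sub (integrable_finsetSum _ fun l _ => h.integrable l)
  have habs : ∫ ω, |W' ω| ∂μ ≤ 1 + 3 * (x + x ^ 2) := by
    have h1 : ∫ ω, |W' ω| ∂μ ≤ ∫ ω, (|W ω| + (Y i ω + Y j ω + Y k ω)) ∂μ := by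
      refine integral_mono hW'int.abs (hWint.abs.add (((hYint i).add (hYint j)).add (hYint k)))
        fun ω => ?_
      have := abs_sub_abs_le_abs_sub (W' ω) (W ω)
      rw [abs_sub_comm] at this
      simp only
      linarith [hdist ω]
    rw [integral_add (g := fun ω => Y i ω + Y j ω + Y k ω) hWint.abs
      (((hYint i).add (hYint j)).add (hYint k)),
      integral_add_three (hYint i) (hYint j) (hYint k)] at h1
    have h2 := h.integral_abs_centeredSum_le
    have h3 := fun i => h.integral_absSum_le hD hp hint hx hM i
    linarith [h3 i, h3 j, h3 k]
  set I' := Set.Ioc (z - 3 * x) (z + 2 * ε + 3 * x) with hI'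
  set I := Set.Ioc (z - 6 * x) (z + 2 * ε + 6 * x) with hI
  have hprob : ∫ ω, I'.indicator (1 : ℝ → ℝ) (W' ω) ∂μ ≤ 0.8 * ε + 7.8 * x + 2 * κ := by
    have hIm : Measurable fun ω => I.indicator (1 : ℝ → ℝ) (W ω) :=
      (measurable_one.indicator measurableSet_Ioc).comp hWm
    have hIint : Integrable (fun ω => I.indicator (1 : ℝ → ℝ) (W ω)) μ := by
      refine Integrable.of_bound hIm.aestronglyMeasurable 1 (Filter.Eventually.of_forall fun ω => ?_)
      by_cases hω : W ω ∈ I <;> simp [hω]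
    have h1 : ∀ ω, I'.indicator (1 : ℝ → ℝ) (W' ω) ≤
        I.indicator (1 : ℝ → ℝ) (W ω) + x ^ (-p) * (Y i ω ^ p + Y j ω ^ p + Y k ω ^ p) := by
      intro ω
      have hp0 : ∀ i, 0 ≤ Y i ω ^ p := fun i => Real.rpow_nonneg (hY0 i ω) _
      have hx0 : 0 ≤ x ^ (-p) := Real.rpow_nonneg hx.le _
      have hI0 : 0 ≤ I.indicator (1 : ℝ → ℝ) (W ω) :=
        Set.indicator_nonneg (fun _ _ => zero_le_one) _
      by_cases hbad : x < Y i ω ∨ x < Y j ω ∨ x < Y k ω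
      · have h2 : ∀ y : ℝ, x < y → 1 ≤ x ^ (-p) * y ^ p := fun y hy => by
          rw [Real.rpow_neg hx.le, ← Real.inv_rpow hx.le, ← Real.mul_rpow (by positivity)
            (hx.trans hy).le, inv_mul_eq_div]
          exact Real.one_le_rpow ((one_le_div hx).2 hy.le) (by linarith)
        have h3 : I'.indicator (1 : ℝ → ℝ) (W' ω) ≤ 1 :=
          Set.indicator_le_self' (fun _ _ => zero_le_one) _
        have h4 : ∀ i, 0 ≤ x ^ (-p) * Y i ω ^ p := fun i => mul_nonneg hx0 (hp0 i)
        rw [mul_add, mul_add]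
        rcases hbad with hb | hb | hb <;> linarith [h2 _ hb, h4 i, h4 j, h4 k]
      · push Not at hbad
        have h4 : 0 ≤ x ^ (-p) * (Y i ω ^ p + Y j ω ^ p + Y k ω ^ p) :=
          mul_nonneg hx0 (add_nonneg (add_nonneg (hp0 i) (hp0 j)) (hp0 k))
        by_cases hω : W' ω ∈ I'
        · have hmem : W ω ∈ I := by
            have h5 := abs_le.1 (hdist ω)
            exact ⟨by linarith [hω.1, h5.1, hbad.1, hbad.2.1, hbad.2.2],
              by linarith [hω.2, h5.2, hbad.1, hbad.2.1, hbad.2.2]⟩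
          rw [Set.indicator_of_mem hω, Set.indicator_of_mem hmem]
          simp only [Pi.one_apply]
          linarith
        · rw [Set.indicator_of_notMem hω]
          linarith
    have hYY : Integrable (fun ω => Y i ω ^ p + Y j ω ^ p + Y k ω ^ p) μ :=
      ((hYp i).add (hYp j)).add (hYp k)
    have h2 := integral_mono_of_nonneg
      (Filter.Eventually.of_forall fun ω =>
        Set.indicator_nonneg (s := I') (f := (1 : ℝ → ℝ)) (fun _ _ => zero_le_one) (W' ω))
      (hIint.add (hYY.const_mul (x ^ (-p)))) (Filter.Eventually.of_forall h1)
    simp only [Pi.add_apply] at h2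
    rw [integral_add hIint (hYY.const_mul _), integral_const_mul,
      integral_add_three (hYp i) (hYp j) (hYp k)] at h2
    have h3 : ∀ i, x ^ (-p) * ∫ ω, Y i ω ^ p ∂μ ≤ x := fun i => by
      refine (mul_le_mul_of_nonneg_left (h.integral_absSum_rpow_le_of_le hD hp hint hM i)
        (Real.rpow_nonneg hx.le _)).trans (le_of_eq ?_)
      rw [← Real.rpow_add hx, neg_add_cancel_left, Real.rpow_one]
    have h4 : ∫ ω, I.indicator (1 : ℝ → ℝ) (W ω) ∂μ = (μ.map W).real I := by
      rw [← integral_indicator_one measurableSet_Ioc, integral_map hWm.aemeasurable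
        (measurable_one.indicator measurableSet_Ioc).aestronglyMeasurable]
    have := Measure.isProbabilityMeasure_map (μ := μ) hWm.aemeasurable
    have hab : z - 6 * x ≤ z + 2 * ε + 6 * x := by linarith
    have h5 := measureReal_Ioc_le_add_kolDist (P := μ.map W) (Q := gaussianReal 0 1) hab
    have h6 := gaussianReal_real_Ioc_le hab
    rw [← hI] at h5 h6
    have h7 := h3 i
    have h8 := h3 j
    have h9 := h3 k
    rw [h4] at h2
    linarith
  have hI'm : Measurable fun ω => I'.indicator (1 : ℝ → ℝ) (W' ω) :=
    (measurable_one.indicator measurableSet_Ioc).comp hW'm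
  have hI'int : Integrable (fun ω => I'.indicator (1 : ℝ → ℝ) (W' ω)) μ := by
    refine Integrable.of_bound hI'm.aestronglyMeasurable 1 (Filter.Eventually.of_forall fun ω => ?_)
    by_cases hω : W' ω ∈ I' <;> simp [hω]
  have hA : Integrable (fun ω => 1.26 + |W' ω| + 3 * x) μ :=
    ((integrable_const _).add hW'int.abs).add (integrable_const _)
  refine ⟨hA.add (hI'int.const_mul _), ?_⟩
  have h1 : ∫ ω, localBound z ε (3 * x) (W' ω) ∂μ =
      1.26 + ∫ ω, |W' ω| ∂μ + 3 * x + 1 / ε * ∫ ω, I'.indicator (1 : ℝ → ℝ) (W' ω) ∂μ := by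
    simp only [localBound]
    rw [integral_add hA (hI'int.const_mul _), integral_const_mul,
      integral_add (f := fun ω => 1.26 + |W' ω|) ((integrable_const _).add hW'int.abs)
        (integrable_const _), integral_add (integrable_const _) hW'int.abs]
    simp only [integral_const, probReal_univ, one_smul]
  rw [h1]
  have h2 := mul_le_mul_of_nonneg_left hprob (one_div_pos.2 hε).le
  have h3 : 1 / ε * (0.8 * ε + 7.8 * x + 2 * κ) = 0.8 + 1 / ε * (7.8 * x + 2 * κ) := by
    field_simp
    ring
  rw [h3] at h2
  linarith

/-- Contribution of the event that one of the neighbourhood sums exceeds `x`. -/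
theorem pairMajorant_mul_indicator_le (h : IsLocallyDependent η N D μ) (hD : 0 < D) {p x : ℝ}
    (hp : 3 ≤ p) (hint : ∀ i, Integrable (fun ω => |η i ω| ^ p) μ) (hx : 0 < x) (i j k : ι)
    {q : Ω → ℝ} (hqm : Measurable q)
    (hq : ∀ ω, q ω = |η k ω| * {ω | x < absSum η (N i) ω ∨ x < absSum η (N j) ω ∨
      x < absSum η (N k) ω}.indicator 1 ω)
    {m : ι → ℝ} (hm : ∀ i, m i = ∫ ω, |η i ω| ^ p ∂μ + D⁻¹ * ∑ l ∈ N i, ∫ ω, |η l ω| ^ p ∂μ) :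
    Integrable (fun ω => pairMajorant η μ i j ω * q ω) μ ∧
    ∫ ω, pairMajorant η μ i j ω * q ω ∂μ ≤ 2 * (x / D) ^ (3 - p) * (m i + m j + m k) ∧
    (∫ ω, pairMajorant η μ i j ω ∂μ) * ∫ ω, q ω ∂μ ≤
      2 * (x / D) ^ (3 - p) * (m i + m j + m k) := by
  set Y : ι → Ω → ℝ := fun i => absSum η (N i) with hY
  have hY0 : ∀ i ω, 0 ≤ Y i ω := fun i ω => absSum_nonneg _ _ _
  have hYint : ∀ i, Integrable (fun ω => (Y i ω / D) ^ p) μ := fun i => by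
    have h1 := (h.integrable_absSum_rpow (by linarith) hint (N i)).div_const (D ^ p)
    refine h1.congr (Filter.Eventually.of_forall fun ω => ?_)
    simp only
    rw [Real.div_rpow (hY0 i ω) hD.le]
  set v : Ω → ℝ := fun ω =>
    |η k ω| ^ p + (Y i ω / D) ^ p + (Y j ω / D) ^ p + (Y k ω / D) ^ p with hv
  have hvint : Integrable v μ := (((hint k).add (hYint i)).add (hYint j)).add (hYint k)
  have hκ : 0 < x / D := div_pos hx hD
  have hYD : ∀ i ω, 0 ≤ Y i ω / D := fun i ω => div_nonneg (hY0 i ω) hD.le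
  have hv0 : ∀ ω, 0 ≤ v ω := fun ω => by
    have h1 := fun i => Real.rpow_nonneg (hYD i ω) p
    have h2 := Real.rpow_nonneg (abs_nonneg (η k ω)) p
    simp only [hv]
    linarith [h1 i, h1 j, h1 k]
  have hvle : ∫ ω, v ω ∂μ ≤ ∫ ω, |η k ω| ^ p ∂μ + D⁻¹ * ∑ l ∈ N i, ∫ ω, |η l ω| ^ p ∂μ +
      D⁻¹ * ∑ l ∈ N j, ∫ ω, |η l ω| ^ p ∂μ + D⁻¹ * ∑ l ∈ N k, ∫ ω, |η l ω| ^ p ∂μ := by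
    simp only [hv]
    rw [integral_add_three (a := fun ω => |η k ω| ^ p + (Y i ω / D) ^ p)
      ((hint k).add (hYint i)) (hYint j) (hYint k), integral_add (hint k) (hYint i)]
    have h1 := fun i => h.integral_absSum_div_rpow_le hD (by linarith) hint i
    simp only [hY]
    linarith [h1 i, h1 j, h1 k]
  have hq0 : ∀ ω, 0 ≤ q ω := fun ω => by
    rw [hq]
    exact mul_nonneg (abs_nonneg _) (Set.indicator_nonneg (fun _ _ => zero_le_one) _)
  have hpair := h.pairMajorant_mul_le (K := (x / D) ^ (3 - p)) hint hqm hq0 hvint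
    (fun ω a b ha hb => by
      rw [hq]
      by_cases hω : ω ∈ {ω | x < Y i ω ∨ x < Y j ω ∨ x < Y k ω}
      · rw [Set.indicator_of_mem hω, Pi.one_apply, mul_one]
        refine mul_mul_le_of_exists_lt ha hb (abs_nonneg _) (hYD i ω) (hYD j ω) (hYD k ω) hκ hp ?_
        have hω' : x < Y i ω ∨ x < Y j ω ∨ x < Y k ω := hω
        simpa only [div_lt_div_iff_of_pos_right hD] using hω'
      · rw [Set.indicator_of_notMem hω, mul_zero, mul_zero]
        exact mul_nonneg (Real.rpow_nonneg hκ.le _) (add_nonneg (add_nonneg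
          (Real.rpow_nonneg ha _) (Real.rpow_nonneg hb _)) (hv0 ω))) i j
  have hle : 2 * (x / D) ^ (3 - p) *
      (∫ ω, |η i ω| ^ p ∂μ + ∫ ω, |η j ω| ^ p ∂μ + ∫ ω, v ω ∂μ) ≤
      2 * (x / D) ^ (3 - p) * (m i + m j + m k) := by
    refine mul_le_mul_of_nonneg_left ?_ (by positivity)
    rw [hm, hm, hm]
    linarith
  exact ⟨hpair.1, hpair.2.1.trans hle, hpair.2.2.trans hle⟩

/-- Contribution of the event that the neighbourhood sums are small: the remaining sum is
independent of the triple `i, j, k`. -/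
theorem pairMajorant_mul_localBound_le (h : IsLocallyDependent η N D μ) {z ε r Γ : ℝ} (hε : 0 < ε)
    (hr : 0 ≤ r) (hint3 : ∀ i, Integrable (fun ω => |η i ω| ^ (3 : ℝ)) μ) (i j k : ι)
    (hb : Integrable (fun ω => localBound z ε r (remoteSum η μ (N i ∪ N j ∪ N k) ω)) μ)
    (hΓ : ∫ ω, localBound z ε r (remoteSum η μ (N i ∪ N j ∪ N k) ω) ∂μ ≤ Γ)
    {m : ι → ℝ} (hm : ∀ i, m i = ∫ ω, |η i ω| ^ (3 : ℝ) ∂μ) :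
    Integrable (fun ω => |η k ω| * localBound z ε r (remoteSum η μ (N i ∪ N j ∪ N k) ω)) μ ∧
    Integrable (fun ω => pairMajorant η μ i j ω *
      (|η k ω| * localBound z ε r (remoteSum η μ (N i ∪ N j ∪ N k) ω))) μ ∧
    ∫ ω, pairMajorant η μ i j ω *
      (|η k ω| * localBound z ε r (remoteSum η μ (N i ∪ N j ∪ N k) ω)) ∂μ ≤
        2 / 3 * Γ * (m i + m j + m k) ∧
    (∫ ω, pairMajorant η μ i j ω ∂μ) * ∫ ω,
      |η k ω| * localBound z ε r (remoteSum η μ (N i ∪ N j ∪ N k) ω) ∂μ ≤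
        2 / 3 * Γ * (m i + m j + m k) := by
  set W' := remoteSum η μ (N i ∪ N j ∪ N k) with hW'
  have hi : N i ⊆ N i ∪ N j ∪ N k :=
    Finset.subset_union_left.trans Finset.subset_union_left
  have hj : N j ⊆ N i ∪ N j ∪ N k :=
    Finset.subset_union_right.trans Finset.subset_union_left
  have hk : N k ⊆ N i ∪ N j ∪ N k := Finset.subset_union_right
  have hpair := h.pairMajorant_mul_le (p := 3) (K := 1 / 3) hint3 (q := fun ω => |η k ω|)
    (v := fun ω => |η k ω| ^ (3 : ℝ)) (h.measurable k).abs (fun ω => abs_nonneg _) (hint3 k)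
    (fun ω a b ha hb => mul_mul_le_third ha hb (abs_nonneg _)) i j
  have hbm : Measurable fun ω => localBound z ε r (W' ω) :=
    (measurable_localBound z ε r).comp (h.measurable_remoteSum _)
  have hind1 : IndepFun (fun ω => |η k ω|) (fun ω => localBound z ε r (W' ω)) μ :=
    (h.indepFun_remoteSum hi hj hk (u := fun t => |t.2.2|) (by fun_prop)).comp measurable_id
      (measurable_localBound z ε r)
  have hind2 : IndepFun (fun ω => pairMajorant η μ i j ω * |η k ω|)
      (fun ω => localBound z ε r (W' ω)) μ :=
    (h.indepFun_remoteSum hi hj hk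
      (u := fun t => (|t.1| + ∫ ω', |η i ω'| ∂μ) * |t.2.1| * |t.2.2|) (by fun_prop)).comp
      measurable_id (measurable_localBound z ε r)
  have hb0 : 0 ≤ ∫ ω, localBound z ε r (W' ω) ∂μ :=
    integral_nonneg fun ω => localBound_nonneg hε hr _
  have hm0 : 0 ≤ m i + m j + m k := by
    have : ∀ i, 0 ≤ m i := fun i => by
      rw [hm]
      exact integral_nonneg fun ω => Real.rpow_nonneg (abs_nonneg _) _
    linarith [this i, this j, this k]
  have hfin : ∀ a : ℝ, a ≤ 2 * (1 / 3) * (∫ ω, |η i ω| ^ (3 : ℝ) ∂μ +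
      ∫ ω, |η j ω| ^ (3 : ℝ) ∂μ + ∫ ω, |η k ω| ^ (3 : ℝ) ∂μ) →
      a * ∫ ω, localBound z ε r (W' ω) ∂μ ≤ 2 / 3 * Γ * (m i + m j + m k) := by
    intro a ha
    rw [← hm, ← hm, ← hm] at ha
    calc a * ∫ ω, localBound z ε r (W' ω) ∂μ
        ≤ 2 * (1 / 3) * (m i + m j + m k) * ∫ ω, localBound z ε r (W' ω) ∂μ :=
          mul_le_mul_of_nonneg_right ha hb0
      _ ≤ 2 * (1 / 3) * (m i + m j + m k) * Γ := mul_le_mul_of_nonneg_left hΓ (by positivity)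
      _ = _ := by ring
  refine ⟨hind1.integrable_mul (h.integrable k).abs hb, ?_, ?_, ?_⟩
  · refine (hind2.integrable_mul hpair.1 hb).congr (Filter.Eventually.of_forall fun ω => ?_)
    simp only [Pi.mul_apply]
    ring
  · simp_rw [← mul_assoc]
    rw [hind2.integral_fun_mul_eq_mul_integral hpair.1.aestronglyMeasurable hbm.aestronglyMeasurable]
    exact hfin _ hpair.2.1
  · rw [hind1.integral_fun_mul_eq_mul_integral (h.measurable k).abs.aestronglyMeasurable
      hbm.aestronglyMeasurable, ← mul_assoc]
    exact hfin _ hpair.2.2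

/-- The error in Stein's identity, in terms of the Kolmogorov distance itself. -/
theorem abs_integral_stein_le_of_three_le (h : IsLocallyDependent η N D μ) (hD : 0 < D)
    {p x β ε : ℝ} (hp : 3 ≤ p) (hint : ∀ i, Integrable (fun ω => |η i ω| ^ p) μ)
    (hint3 : ∀ i, Integrable (fun ω => |η i ω| ^ (3 : ℝ)) μ) (hx : 0 < x) (hε : 0 < ε)
    (hM : D ^ (p - 1) * ∑ i, ∫ ω, |η i ω| ^ p ∂μ ≤ x ^ (p + 1))
    (hβ : D ^ 2 * ∑ i, ∫ ω, |η i ω| ^ (3 : ℝ) ∂μ ≤ β)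
    {z : ℝ} {u f g g' : ℝ → ℝ} (hs : IsSteinSolution z ε u f g g') :
    |∫ ω, (g (centeredSum η μ ω) - centeredSum η μ ω * f (centeredSum η μ ω)) ∂μ| ≤
      10 * β * (3.06 + 6 * x + 3 * x ^ 2 +
        1 / ε * (7.8 * x + 2 * kolDist (μ.map (centeredSum η μ)) (gaussianReal 0 1))) +
      120 * (1 / ε + 1.26) * x ^ 4 := by
  set Γ : ℝ := 3.06 + 6 * x + 3 * x ^ 2 +
    1 / ε * (7.8 * x + 2 * kolDist (μ.map (centeredSum η μ)) (gaussianReal 0 1)) with hΓ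
  set R : ℝ := 1 / ε + 1.26 with hR
  have hR0 : 0 < R := by positivity
  have hr : 0 ≤ 3 * x := by positivity
  set Y : ι → Ω → ℝ := fun i => absSum η (N i) with hY
  have hY0 : ∀ i ω, 0 ≤ Y i ω := fun i ω => absSum_nonneg _ _ _
  have hYm : ∀ i, Measurable (Y i) := fun i => h.measurable_absSum _
  set M : ι → ℝ := fun i => ∫ ω, |η i ω| ^ p ∂μ with hMdef
  have hM0 : ∀ i, 0 ≤ M i := fun i => integral_nonneg fun ω => Real.rpow_nonneg (abs_nonneg _) _
  set m : ι → ℝ := fun i => M i + D⁻¹ * ∑ l ∈ N i, M l with hm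
  have hm0 : ∀ i, 0 ≤ m i := fun i => add_nonneg (hM0 i)
    (mul_nonneg (inv_nonneg.2 hD.le) (Finset.sum_nonneg fun l _ => hM0 l))
  set m3 : ι → ℝ := fun i => ∫ ω, |η i ω| ^ (3 : ℝ) ∂μ with hm3
  have hm30 : ∀ i, 0 ≤ m3 i := fun i =>
    integral_nonneg fun ω => Real.rpow_nonneg (abs_nonneg _) _
  set bad : ι → ι → ι → Set Ω := fun i j k =>
    {ω | x < absSum η (N i) ω ∨ x < absSum η (N j) ω ∨ x < absSum η (N k) ω} with hbad
  have hbadm : ∀ i j k, MeasurableSet (bad i j k) := fun i j k =>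
    (measurableSet_lt measurable_const (hYm i)).union
      ((measurableSet_lt measurable_const (hYm j)).union
        (measurableSet_lt measurable_const (hYm k)))
  set a : ι → ι → ι → Ω → ℝ := fun i j k ω =>
    |η k ω| * localBound z ε (3 * x) (remoteSum η μ (N i ∪ N j ∪ N k) ω) with ha
  set b : ι → ι → ι → Ω → ℝ := fun i j k ω => |η k ω| * (bad i j k).indicator 1 ω with hb
  have hbm : ∀ i j k, Measurable (b i j k) := fun i j k =>
    (h.measurable k).abs.mul (measurable_one.indicator (hbadm i j k))
  have hbint : ∀ i j k, Integrable (b i j k) μ := fun i j k => by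
    refine (h.integrable k).abs.mono' (hbm i j k).aestronglyMeasurable
      (Filter.Eventually.of_forall fun ω => ?_)
    simp only [hb]
    by_cases hω : ω ∈ bad i j k <;> simp [hω]
  set ψ : ι → ι → ι → Ω → ℝ := fun i j k ω => a i j k ω + 2 * R * b i j k ω with hψ
  have hloc := fun i j k => h.integral_localBound_le hD (by linarith) hint hx hM hε z i j k
  have hA := fun i j k => h.pairMajorant_mul_localBound_le (Γ := Γ) hε hr hint3 i j k (hloc i j k).1
    (hloc i j k).2 (m := m3) fun _ => rfl
  have hB := fun i j k => h.pairMajorant_mul_indicator_le hD hp hint hx i j k (hbm i j k)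
    (fun ω => rfl) (m := m) fun _ => rfl
  set K : ℝ := 4 * R * (x / D) ^ (3 - p) with hK
  have hK0 : 0 ≤ K := by positivity
  have hψint : ∀ i j k, Integrable (ψ i j k) μ := fun i j k =>
    (hA i j k).1.add ((hbint i j k).const_mul _)
  have hAψ : ∀ i j k ω, pairMajorant η μ i j ω * ψ i j k ω =
      pairMajorant η μ i j ω * a i j k ω + 2 * R * (pairMajorant η μ i j ω * b i j k ω) :=
    fun i j k ω => by simp only [hψ]; ring
  have hAψint : ∀ i j k, Integrable (fun ω => pairMajorant η μ i j ω * ψ i j k ω) μ :=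
    fun i j k => by
      simp_rw [hAψ]
      exact (hA i j k).2.1.add ((hB i j k).1.const_mul _)
  set c : ι → ι → ι → ℝ := fun i j k =>
    2 / 3 * Γ * (m3 i + m3 j + m3 k) + K * (m i + m j + m k) with hc
  have hψ1 : ∀ i j k, ∫ ω, pairMajorant η μ i j ω * ψ i j k ω ∂μ ≤ c i j k := fun i j k => by
    simp_rw [hAψ]
    rw [integral_add (hA i j k).2.1 ((hB i j k).1.const_mul _), integral_const_mul]
    have h1 := mul_le_mul_of_nonneg_left (hB i j k).2.1 (show 0 ≤ 2 * R by positivity)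
    have h2 := (hA i j k).2.2.1
    simp only [hc, hK]
    linarith
  have hψ2 : ∀ i j k, (∫ ω, pairMajorant η μ i j ω ∂μ) * ∫ ω, ψ i j k ω ∂μ ≤ c i j k :=
    fun i j k => by
      simp only [hψ]
      rw [integral_add (hA i j k).1 ((hbint i j k).const_mul _), integral_const_mul, mul_add]
      have h1 := mul_le_mul_of_nonneg_left (hB i j k).2.2 (show 0 ≤ 2 * R by positivity)
      have h2 := (hA i j k).2.2.2
      simp only [hc, hK]
      linarith
  -- A bound for `f''(v)` at every point `v` whose distance from the remaining sum is at most the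
  -- total of the neighbourhood sums.
  have hψbound : ∀ i j k ω (v : ℝ),
      |v - remoteSum η μ (N i ∪ N j ∪ N k) ω| ≤ Y i ω + Y j ω + Y k ω →
      |η k ω| * |g' v| ≤ ψ i j k ω := by
    intro i j k ω v hv
    simp only [hψ, ha, hb]
    by_cases hω : ω ∈ bad i j k
    · rw [Set.indicator_of_mem hω, Pi.one_apply, mul_one]
      have h1 := mul_le_mul_of_nonneg_left (hs.abs_g'_le v) (abs_nonneg (η k ω))
      rw [← hR] at h1
      have h2 := mul_nonneg (abs_nonneg (η k ω))
        (localBound_nonneg (z := z) hε hr (remoteSum η μ (N i ∪ N j ∪ N k) ω))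
      linarith
    · rw [Set.indicator_of_notMem hω, mul_zero, mul_zero, add_zero]
      have hω' : ¬ (x < Y i ω ∨ x < Y j ω ∨ x < Y k ω) := hω
      push Not at hω'
      exact mul_le_mul_of_nonneg_left (hs.abs_g'_le_localBound hε
        (hv.trans (by linarith [hω'.1, hω'.2.1, hω'.2.2]))) (abs_nonneg _)
  have hpoint : ∀ i j k ω (s : Finset ι) (t : ℝ), s ⊆ N i ∪ N j ∪ N k → t ∈ Set.Icc (0 : ℝ) 1 →
      |centeredSum η μ ω - t * ∑ l ∈ s, η l ω - remoteSum η μ (N i ∪ N j ∪ N k) ω| ≤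
        Y i ω + Y j ω + Y k ω := by
    intro i j k ω s t hs ht
    have h1 := abs_sum_sub_mul_sum_le η hs ht ω
    rw [remoteSum, show centeredSum η μ ω - t * ∑ l ∈ s, η l ω -
      (centeredSum η μ ω - ∑ l ∈ N i ∪ N j ∪ N k, η l ω) =
      ∑ l ∈ N i ∪ N j ∪ N k, η l ω - t * ∑ l ∈ s, η l ω by ring]
    refine h1.trans ((absSum_union_le η _ _ ω).trans ?_)
    exact add_le_add_left (absSum_union_le η _ _ ω) _
  set Q : ι → ι → Ω → ℝ := fun i j ω => ∑ k ∈ N i, ψ i j k ω + ∑ k ∈ N j, ψ i j k ω with hQ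
  have hAQ : ∀ i j ω, pairMajorant η μ i j ω * Q i j ω =
      ∑ k ∈ N i, pairMajorant η μ i j ω * ψ i j k ω +
        ∑ k ∈ N j, pairMajorant η μ i j ω * ψ i j k ω := fun i j ω => by
    simp only [hQ, mul_add, Finset.mul_sum]
  have hsumint : ∀ i j (s : Finset ι),
      Integrable (fun ω => ∑ k ∈ s, pairMajorant η μ i j ω * ψ i j k ω) μ :=
    fun i j s => integrable_finsetSum _ fun k _ => hAψint i j k
  have hsumint' : ∀ i j (s : Finset ι), Integrable (fun ω => ∑ k ∈ s, ψ i j k ω) μ :=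
    fun i j s => integrable_finsetSum _ fun k _ => hψint i j k
  have hψ0 : ∀ i j k ω, 0 ≤ ψ i j k ω := fun i j k ω =>
    (mul_nonneg (abs_nonneg _) (abs_nonneg _)).trans
      (hψbound i j k ω (remoteSum η μ (N i ∪ N j ∪ N k) ω) (by
        rw [sub_self, abs_zero]
        exact add_nonneg (add_nonneg (hY0 i ω) (hY0 j ω)) (hY0 k ω)))
  have hmain := h.abs_integral_stein_le (f := f) (g := g) (Q := Q)
    (continuous_iff_continuousAt.2 fun w => (hs.hasDerivAt_f w).continuousAt).measurable
    (continuous_iff_continuousAt.2 fun w => (hs.hasDerivAt_g w).continuousAt).measurable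
    hs.abs_f_le hs.abs_g_le (fun i j => (hsumint' i j _).add (hsumint' i j _))
    (fun i j => by
      simp_rw [hAQ]
      exact (hsumint i j _).add (hsumint i j _))
    (fun i j _ ω => by
      obtain ⟨t, ht, ht'⟩ := exists_taylor_one hs.hasDerivAt_g (centeredSum η μ ω)
        (∑ l ∈ N i ∪ N j, η l ω)
      have h1 : |∑ l ∈ N i ∪ N j, η l ω| ≤ ∑ k ∈ N i, |η k ω| + ∑ k ∈ N j, |η k ω| :=
        (abs_sum_le_absSum subset_rfl ω).trans (absSum_union_le η _ _ ω)
      rw [remoteSum, ht', abs_mul]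
      refine (mul_le_mul_of_nonneg_right h1 (abs_nonneg _)).trans ?_
      rw [add_mul, Finset.sum_mul, Finset.sum_mul]
      exact add_le_add
        (Finset.sum_le_sum fun k _ => hψbound i j k ω _
          (hpoint i j k ω _ t Finset.subset_union_left ht))
        (Finset.sum_le_sum fun k _ => hψbound i j k ω _
          (hpoint i j k ω _ t Finset.subset_union_left ht)))
    (fun i ω => by
      obtain ⟨t, ht, ht'⟩ := exists_taylor_two hs.hasDerivAt_f hs.hasDerivAt_g
        (centeredSum η μ ω) (∑ l ∈ N i, η l ω)
      set y := ∑ l ∈ N i, η l ω with hy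
      have hyle : |y| ≤ ∑ k ∈ N i, |η k ω| := Finset.abs_sum_le_sum_abs _ _
      have h1 : ∀ j, |y| * |g' (centeredSum η μ ω - t * y)| ≤ Q i j ω := fun j => by
        refine (mul_le_mul_of_nonneg_right hyle (abs_nonneg _)).trans ?_
        rw [Finset.sum_mul]
        refine (Finset.sum_le_sum fun k _ => hψbound i j k ω _ (hpoint i j k ω _ t
          (Finset.subset_union_left.trans Finset.subset_union_left) ht)).trans ?_
        exact le_add_of_nonneg_right (Finset.sum_nonneg fun k _ => hψ0 i j k ω)
      rw [remoteSum, ht', abs_neg, abs_mul, abs_of_nonneg (by positivity : 0 ≤ y ^ 2 / 2),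
        ← sq_abs, show |y| ^ 2 / 2 * |g' (centeredSum η μ ω - t * y)| =
          1 / 2 * (|y| * (|y| * |g' (centeredSum η μ ω - t * y)|)) by ring]
      refine mul_le_mul_of_nonneg_left ?_ (by norm_num)
      refine (mul_le_mul_of_nonneg_right hyle (mul_nonneg (abs_nonneg _) (abs_nonneg _))).trans ?_
      rw [Finset.sum_mul]
      exact Finset.sum_le_sum fun j _ => mul_le_mul_of_nonneg_left (h1 j) (abs_nonneg _))
  refine hmain.trans ?_
  have hterm : ∀ i j, 3 / 2 * ∫ ω, pairMajorant η μ i j ω * Q i j ω ∂μ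
      + (∫ ω, pairMajorant η μ i j ω ∂μ) * ∫ ω, Q i j ω ∂μ ≤
      5 / 2 * (∑ k ∈ N i, c i j k + ∑ k ∈ N j, c i j k) := by
    intro i j
    simp_rw [hAQ]
    simp only [hQ]
    rw [integral_add (hsumint i j _) (hsumint i j _), integral_add (hsumint' i j _) (hsumint' i j _),
      integral_finsetSum _ fun k _ => hAψint i j k, integral_finsetSum _ fun k _ => hAψint i j k,
      integral_finsetSum _ fun k _ => hψint i j k, integral_finsetSum _ fun k _ => hψint i j k,
      mul_add (∫ ω, pairMajorant η μ i j ω ∂μ), Finset.mul_sum, Finset.mul_sum]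
    have h1 := fun s : Finset ι => Finset.sum_le_sum fun k (_ : k ∈ s) => hψ1 i j k
    have h2 := fun s : Finset ι => Finset.sum_le_sum fun k (_ : k ∈ s) => hψ2 i j k
    linarith [h1 (N i), h1 (N j), h2 (N i), h2 (N j)]
  have hsplit : ∀ i j, 5 / 2 * (∑ k ∈ N i, c i j k + ∑ k ∈ N j, c i j k) =
      5 / 3 * Γ * (∑ k ∈ N i, (m3 i + m3 j + m3 k) + ∑ k ∈ N j, (m3 i + m3 j + m3 k)) +
      5 / 2 * K * (∑ k ∈ N i, (m i + m j + m k) + ∑ k ∈ N j, (m i + m j + m k)) := by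
    intro i j
    have hsc : ∀ s : Finset ι, ∑ k ∈ s, c i j k = 2 / 3 * Γ * ∑ k ∈ s, (m3 i + m3 j + m3 k) +
        K * ∑ k ∈ s, (m i + m j + m k) := fun s => by
      rw [Finset.mul_sum, Finset.mul_sum, ← Finset.sum_add_distrib]
    rw [hsc, hsc]
    ring
  have hΓ0 : 0 ≤ Γ := by
    have h1 := abs_nonneg ((μ.map (centeredSum η μ)).real (Set.Iic 0) -
      (gaussianReal 0 1).real (Set.Iic 0))
    have := Measure.isProbabilityMeasure_map (μ := μ) h.measurable_centeredSum.aemeasurable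
    have h2 := h1.trans (abs_sub_le_kolDist (P := μ.map (centeredSum η μ))
      (Q := gaussianReal 0 1) 0)
    positivity
  calc ∑ i, ∑ j ∈ N i, (3 / 2 * ∫ ω, pairMajorant η μ i j ω * Q i j ω ∂μ
        + (∫ ω, pairMajorant η μ i j ω ∂μ) * ∫ ω, Q i j ω ∂μ)
      ≤ ∑ i, ∑ j ∈ N i,
        (5 / 3 * Γ * (∑ k ∈ N i, (m3 i + m3 j + m3 k) + ∑ k ∈ N j, (m3 i + m3 j + m3 k)) +
        5 / 2 * K * (∑ k ∈ N i, (m i + m j + m k) + ∑ k ∈ N j, (m i + m j + m k))) :=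
        Finset.sum_le_sum fun i _ => Finset.sum_le_sum fun j _ =>
          (hterm i j).trans_eq (hsplit i j)
    _ = 5 / 3 * Γ * (∑ i, ∑ j ∈ N i,
          (∑ k ∈ N i, (m3 i + m3 j + m3 k) + ∑ k ∈ N j, (m3 i + m3 j + m3 k))) +
        5 / 2 * K * (∑ i, ∑ j ∈ N i,
          (∑ k ∈ N i, (m i + m j + m k) + ∑ k ∈ N j, (m i + m j + m k))) := by
        rw [Finset.mul_sum, Finset.mul_sum, ← Finset.sum_add_distrib]
        refine Finset.sum_congr rfl fun i _ => ?_
        rw [Finset.mul_sum, Finset.mul_sum, ← Finset.sum_add_distrib]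
    _ ≤ 5 / 3 * Γ * (6 * D ^ 2 * ∑ i, m3 i) + 5 / 2 * K * (6 * D ^ 2 * (2 * ∑ i, M i)) := by
        refine add_le_add (mul_le_mul_of_nonneg_left
          (sum_nbhd_triple_le h.mem_symm h.card_le hm30 hD.le) (by positivity))
          (mul_le_mul_of_nonneg_left ?_ (by positivity))
        refine (sum_nbhd_triple_le h.mem_symm h.card_le hm0 hD.le).trans ?_
        exact mul_le_mul_of_nonneg_left
          (sum_add_inv_mul_sum_nbhd_le h.mem_symm h.card_le hM0 hD) (by positivity)
    _ = 10 * (D ^ 2 * ∑ i, m3 i) * Γ +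
        120 * R * (x ^ (3 - p) * (D ^ (p - 1) * ∑ i, M i)) := by
        rw [hK, Real.div_rpow hx.le hD.le, show D ^ (p - 1) = D ^ 2 * (D ^ (3 - p))⁻¹ by
          rw [← Real.rpow_neg hD.le, ← Real.rpow_natCast, ← Real.rpow_add hD]
          congr 1
          push_cast
          ring]
        ring
    _ ≤ 10 * β * Γ + 120 * R * (x ^ (3 - p) * x ^ (p + 1)) := by
        have := Real.rpow_nonneg hx.le (3 - p)
        gcongr
    _ = 10 * β * Γ + 120 * R * x ^ 4 := by
        rw [← Real.rpow_add hx, show 3 - p + (p + 1) = (4 : ℝ) by ring, Real.rpow_ofNat]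

/-- The Kolmogorov bound for moments of order `p ≥ 3`. The Kolmogorov distance enters its own bound
through the concentration of the remaining sums; the smoothing scale `40 β + x / 2` makes its
coefficient at most one half. -/
theorem kolDist_le_of_three_le (h : IsLocallyDependent η N D μ) (hD : 0 < D) {p x β : ℝ}
    (hp : 3 ≤ p) (hint : ∀ i, Integrable (fun ω => |η i ω| ^ p) μ)
    (hint3 : ∀ i, Integrable (fun ω => |η i ω| ^ (3 : ℝ)) μ) (hx : 0 < x) (hx' : x ≤ 1 / 18)
    (hM : D ^ (p - 1) * ∑ i, ∫ ω, |η i ω| ^ p ∂μ ≤ x ^ (p + 1)) (hβ0 : 0 ≤ β)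
    (hβ : D ^ 2 * ∑ i, ∫ ω, |η i ω| ^ (3 : ℝ) ∂μ ≤ β) :
    kolDist (μ.map (centeredSum η μ)) (gaussianReal 0 1) ≤ 133 * β + 6.3 * x := by
  set κ := kolDist (μ.map (centeredSum η μ)) (gaussianReal 0 1) with hκ
  set ε : ℝ := 40 * β + x / 2 with hεdef
  have hε : 0 < ε := by positivity
  have hκ0 : 0 ≤ κ := Real.iSup_nonneg fun t => abs_nonneg _
  have h1 : κ ≤ 0.8 * ε + (10 * β * (3.06 + 6 * x + 3 * x ^ 2 + 1 / ε * (7.8 * x + 2 * κ)) +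
      120 * (1 / ε + 1.26) * x ^ 4) := ciSup_le fun t =>
    h.abs_measureReal_Iic_sub_gaussian_le hε (fun z u f g g' hs =>
      h.abs_integral_stein_le_of_three_le hD hp hint hint3 hx hε hM hβ hs) t
  have h2 : 10 * β * (1 / ε) ≤ 1 / 4 := by
    rw [mul_one_div, div_le_iff₀ hε, hεdef]
    linarith
  have h3 : 1 / ε * x ≤ 2 := by
    rw [one_div_mul_eq_div, div_le_iff₀ hε, hεdef]
    linarith
  have hxx : x * x ≤ 1 / 18 * (1 / 18) := by nlinarith
  have h4 : 10 * β * (6 * x + 3 * x ^ 2) ≤ 10 * β * 0.35 := by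
    refine mul_le_mul_of_nonneg_left ?_ (by positivity)
    rw [sq]
    linarith
  have h5 : 10 * β * (1 / ε) * (7.8 * x + 2 * κ) ≤ 1 / 4 * (7.8 * x + 2 * κ) :=
    mul_le_mul_of_nonneg_right h2 (by positivity)
  have hx3 : x ^ 3 ≤ 1 / 324 * x := by
    rw [show x ^ 3 = x * x * x by ring]
    exact mul_le_mul_of_nonneg_right (by linarith) hx.le
  have hx4 : x ^ 4 ≤ 1 / 5832 * x := by
    rw [show x ^ 4 = x ^ 3 * x by ring]
    refine mul_le_mul_of_nonneg_right ?_ hx.le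
    linarith
  have h6 : 1 / ε * x ^ 4 ≤ 2 * x ^ 3 := by
    rw [show 1 / ε * x ^ 4 = (1 / ε * x) * x ^ 3 by ring]
    exact mul_le_mul_of_nonneg_right h3 (by positivity)
  have h7 : 0.8 * ε = 32 * β + 0.4 * x := by
    rw [hεdef]
    ring
  rw [h7] at h1
  linarith

end IsLocallyDependent

end ThirdMoment

/-! ### Scaling of the moments -/

/-- The moment sums of the scaled terms in terms of `D / M` and `Ξ`, when `σ` is the standard
deviation, `a` a mean norm, `D` the size of the neighbourhoods and `M` a bound for the number of
terms. -/
theorem moment_scaling {D M a Ξ σ p A : ℝ} (hD : 0 < D) (hM : 0 < M) (ha : 0 < a) (hΞ : 0 < Ξ)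
    (hσ : σ = Ξ * a * √(D * M)) (hA : A ≤ M * a ^ p) :
    D ^ (p - 1) * (A / σ ^ p) ≤ (D / M) ^ ((p - 2) / 2) * Ξ ^ (-p) := by
  have hσp : σ ^ p = Ξ ^ p * a ^ p * (D ^ (p / 2) * M ^ (p / 2)) := by
    rw [hσ, Real.mul_rpow (by positivity) (Real.sqrt_nonneg _), Real.mul_rpow hΞ.le ha.le,
      Real.sqrt_eq_rpow, ← Real.rpow_mul (by positivity), Real.mul_rpow hD.le hM.le]
    congr 3 <;> ring
  have hσ0 : 0 < σ ^ p := by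
    rw [hσp]
    positivity
  calc D ^ (p - 1) * (A / σ ^ p) ≤ D ^ (p - 1) * (M * a ^ p / σ ^ p) := by gcongr
    _ = (D ^ (p - 1) / D ^ (p / 2)) * (M / M ^ (p / 2)) * (Ξ ^ p)⁻¹ := by
        rw [hσp]
        have h1 : a ^ p ≠ 0 := by positivity
        field_simp
    _ = (D / M) ^ ((p - 2) / 2) * Ξ ^ (-p) := by
        have h1 : D ^ (p - 1) / D ^ (p / 2) = D ^ ((p - 2) / 2) := by
          rw [← Real.rpow_sub hD]
          congr 1
          ring
        have h2 : M / M ^ (p / 2) = (M ^ ((p - 2) / 2))⁻¹ := by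
          rw [← Real.rpow_neg hM.le, show -((p - 2) / 2) = 1 - p / 2 by ring, Real.rpow_sub hM,
            Real.rpow_one]
        rw [h1, h2, Real.rpow_neg hΞ.le, Real.div_rpow hD.le hM.le, div_eq_mul_inv (D ^ _)]

theorem rpow_le_weighted {s q p : ℝ} (hs : 0 ≤ s) (hq : 0 ≤ q) (hqp : q ≤ p) (hp : 0 < p) :
    s ^ q ≤ q / p * s ^ p + (1 - q / p) := by
  have h := Real.geom_mean_le_arith_mean2_weighted (div_nonneg hq hp.le)
    (sub_nonneg.2 ((div_le_one hp).2 hqp)) (Real.rpow_nonneg hs p) zero_le_one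
    (add_sub_cancel _ _)
  rwa [← Real.rpow_mul hs, mul_div_cancel₀ _ hp.ne', Real.one_rpow, mul_one, mul_one] at h

/-- Comparison of the averages of absolute moments of different orders. -/
theorem sum_integral_rpow_le {Ω ι : Type*} [MeasurableSpace Ω] [Fintype ι] {μ : Measure Ω}
    [IsProbabilityMeasure μ] {Y : ι → Ω → ℝ} {a p q : ℝ} (hq : 0 ≤ q) (hqp : q ≤ p) (hp : 0 < p)
    (ha : 0 < a) (hint : ∀ i, Integrable (fun ω => |Y i ω| ^ p) μ)
    (hsum : ∑ i, ∫ ω, |Y i ω| ^ p ∂μ = Fintype.card ι * a ^ p) :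
    ∑ i, ∫ ω, |Y i ω| ^ q ∂μ ≤ Fintype.card ι * a ^ q := by
  have h1 : ∀ i ω, |Y i ω| ^ q ≤ a ^ q * (q / p * ((a ^ p)⁻¹ * |Y i ω| ^ p) + (1 - q / p)) := by
    intro i ω
    have h2 := rpow_le_weighted (s := |Y i ω| / a) (by positivity) hq hqp hp
    rw [Real.div_rpow (abs_nonneg _) ha.le, Real.div_rpow (abs_nonneg _) ha.le,
      div_le_iff₀' (by positivity), div_eq_inv_mul (|Y i ω| ^ p)] at h2
    exact h2
  have h3 : ∀ i, ∫ ω, |Y i ω| ^ q ∂μ ≤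
      a ^ q * (q / p * ((a ^ p)⁻¹ * ∫ ω, |Y i ω| ^ p ∂μ) + (1 - q / p)) := by
    intro i
    have h4 := integral_mono_of_nonneg
      (Filter.Eventually.of_forall fun ω => Real.rpow_nonneg (abs_nonneg (Y i ω)) q)
      (((((hint i).const_mul (a ^ p)⁻¹).const_mul (q / p)).add
        (integrable_const (1 - q / p))).const_mul (a ^ q)) (Filter.Eventually.of_forall (h1 i))
    simp only [Pi.add_apply] at h4
    rw [integral_const_mul, integral_add (((hint i).const_mul _).const_mul _) (integrable_const _),
      integral_const_mul, integral_const_mul] at h4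
    simpa only [integral_const, probReal_univ, one_smul] using h4
  refine (Finset.sum_le_sum fun i _ => h3 i).trans (le_of_eq ?_)
  rw [← Finset.mul_sum, Finset.sum_add_distrib, ← Finset.mul_sum, ← Finset.mul_sum, hsum,
    Finset.sum_const, Finset.card_univ, nsmul_eq_mul]
  have h5 : a ^ p ≠ 0 := by positivity
  field_simp
  ring

section Variance

variable {Ω ι : Type*} [MeasurableSpace Ω] [Fintype ι] [DecidableEq ι] {η : ι → Ω → ℝ}
  {N : ι → Finset ι} {D : ℝ} {μ : Measure Ω} [IsProbabilityMeasure μ]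

/-- Only the covariances of neighbours contribute to the variance of the sum, which is one. -/
theorem IsLocallyDependent.one_le_mul_sum_sq (h : IsLocallyDependent η N D μ) :
    1 ≤ D * ∑ i, ∫ ω, η i ω ^ 2 ∂μ := by
  have h0 : ∀ i, 0 ≤ ∫ ω, η i ω ^ 2 ∂μ := fun i => integral_nonneg fun ω => sq_nonneg _
  have h1 : ∀ i j, ∫ ω, (η i ω - ∫ ω', η i ω' ∂μ) * η j ω ∂μ ≤
      (∫ ω, η i ω ^ 2 ∂μ + ∫ ω, η j ω ^ 2 ∂μ) / 2 := by
    intro i j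
    have hvar : ∫ ω, (η i ω - ∫ ω', η i ω' ∂μ) ^ 2 ∂μ ≤ ∫ ω, η i ω ^ 2 ∂μ := by
      rw [← variance_eq_integral (h.measurable i).aemeasurable]
      exact variance_le_expectation_sq (h.measurable i).aestronglyMeasurable
    have h2 : ∫ ω, (η i ω - ∫ ω', η i ω' ∂μ) * η j ω ∂μ ≤
        ∫ ω, ((η i ω - ∫ ω', η i ω' ∂μ) ^ 2 + η j ω ^ 2) / 2 ∂μ := by
      refine integral_mono (h.integrable_sub_mul i j)
        (((h.memLp_sub i).integrable_sq.add (h.memLp j).integrable_sq).div_const 2) fun ω => ?_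
      simp only
      nlinarith [sq_nonneg (η i ω - ∫ ω', η i ω' ∂μ - η j ω)]
    rw [integral_div, integral_add (h.memLp_sub i).integrable_sq (h.memLp j).integrable_sq] at h2
    linarith
  calc (1 : ℝ) = ∑ i, ∑ j ∈ N i, ∫ ω, (η i ω - ∫ ω', η i ω' ∂μ) * η j ω ∂μ := by
        rw [← h.sum_integral_sub_mul_sum]
        refine Finset.sum_congr rfl fun i _ => ?_
        rw [← integral_finsetSum _ fun j _ => h.integrable_sub_mul i j]
        simp only [Finset.mul_sum]
    _ ≤ ∑ i, ∑ j ∈ N i, ((∫ ω, η i ω ^ 2 ∂μ) / 2 + (∫ ω, η j ω ^ 2 ∂μ) / 2) :=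
        Finset.sum_le_sum fun i _ => Finset.sum_le_sum fun j _ => by
          simpa only [add_div] using h1 i j
    _ ≤ 2 * D * ∑ i, (∫ ω, η i ω ^ 2 ∂μ) / 2 :=
        sum_nbhd_pair_le (m := fun i => (∫ ω, η i ω ^ 2 ∂μ) / 2) h.mem_symm h.card_le
          fun i => div_nonneg (h0 i) zero_le_two
    _ = D * ∑ i, ∫ ω, η i ω ^ 2 ∂μ := by
        rw [← Finset.sum_div]
        ring

end Variance

/-! ### Dependency neighbourhoods of tuples -/

section Tuples

variable {n ℓ : ℕ}

/-- The tuples that share an index with `α` or contain a neighbour of an index of `α`. -/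
noncomputable def tupleNbhd (G : SimpleGraph (Fin n)) (α : Λ n ℓ) : Finset (Λ n ℓ) :=
  open Classical in
  Finset.univ.filter fun β => ∃ a b, α a = β b ∨ G.Adj (α a) (β b)

theorem mem_tupleNbhd {G : SimpleGraph (Fin n)} {α β : Λ n ℓ} :
    β ∈ tupleNbhd G α ↔ ∃ a b, α a = β b ∨ G.Adj (α a) (β b) := by
  simp [tupleNbhd]

theorem card_tuples_with_coordinate_le (b : Fin ℓ) (v : Fin n) :
    (Finset.univ.filter fun β : Λ n ℓ => β b = v).card ≤ n ^ (ℓ - 1) := by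
  have h1 : Fintype.card ({i : Fin ℓ // i ≠ b} → Fin n) = n ^ (ℓ - 1) := by
    rw [Fintype.card_fun, Fintype.card_fin]
    congr 1
    simp
  rw [← h1, ← Finset.card_univ]
  refine Finset.card_le_card_of_injOn (fun β i => β i) (fun _ _ => Finset.mem_univ _) ?_
  intro β hβ γ hγ hβγ
  simp only [Finset.coe_filter, Finset.mem_univ, true_and, Set.mem_ofPred_eq] at hβ hγ
  ext i
  by_cases hi : i = b
  · rw [hi, hβ, hγ]
  · exact congrArg Fin.val (congrFun hβγ ⟨i, hi⟩)

theorem card_tupleNbhd_le (G : SimpleGraph (Fin n)) [DecidableRel G.Adj] {m : ℕ}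
    (hm : G.maxDegree ≤ m) (α : Λ n ℓ) :
    (tupleNbhd G α).card ≤ ℓ ^ 2 * (m + 1) * n ^ (ℓ - 1) := by
  classical
  have hsub : tupleNbhd G α ⊆ (Finset.univ : Finset (Fin ℓ × Fin ℓ)).biUnion fun p =>
      (insert (α p.1) (G.neighborFinset (α p.1))).biUnion fun v =>
        Finset.univ.filter fun β : Λ n ℓ => β p.2 = v := by
    intro β hβ
    obtain ⟨a, b, hab⟩ := mem_tupleNbhd.1 hβ
    simp only [Finset.mem_biUnion, Finset.mem_univ, true_and, Finset.mem_filter]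
    refine ⟨(a, b), β b, ?_, rfl⟩
    rw [Finset.mem_insert, SimpleGraph.mem_neighborFinset]
    exact hab.imp Eq.symm id
  refine (Finset.card_le_card hsub).trans ?_
  refine (Finset.card_biUnion_le_card_mul _ _ ((m + 1) * n ^ (ℓ - 1)) fun p _ => ?_).trans ?_
  · refine (Finset.card_biUnion_le_card_mul _ _ (n ^ (ℓ - 1))
      fun v _ => card_tuples_with_coordinate_le p.2 v).trans (Nat.mul_le_mul_right _ ?_)
    refine (Finset.card_insert_le _ _).trans (Nat.add_le_add_right ?_ 1)
    rw [SimpleGraph.card_neighborFinset_eq_degree]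
    exact (G.degree_le_maxDegree _).trans hm
  · rw [Finset.card_univ, Fintype.card_prod, Fintype.card_fin]
    exact le_of_eq (by ring)

/-- Functions of tuples inherit the dependency structure of the underlying variables. -/
theorem indepFun_of_tupleNbhd {Ω S : Type*} [MeasurableSpace Ω] [MeasurableSpace S]
    {μ : Measure Ω} {X : Fin n → Ω → S} {G : SimpleGraph (Fin n)} (hG : IsDependencyGraph G X μ)
    {F : Λ n ℓ → (Fin ℓ → S) → ℝ} (hF : ∀ α, Measurable (F α)) {s t : Finset (Λ n ℓ)}
    (hst : ∀ α ∈ s, ∀ β ∈ t, β ∉ tupleNbhd G α) :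
    IndepFun (fun (ω : Ω) (α : s) => F α (tuple X (α : Λ n ℓ) ω))
      (fun (ω : Ω) (β : t) => F β (tuple X (β : Λ n ℓ) ω)) μ := by
  set V : Finset (Λ n ℓ) → Set (Fin n) := fun s => {v | ∃ α ∈ s, ∃ a, α a = v} with hV
  have h1 := hG (V s) (V t)
    (Set.disjoint_left.2 fun v => by
      rintro ⟨α, hα, a, rfl⟩ ⟨β, hβ, b, hb⟩
      exact hst α hα β hβ (mem_tupleNbhd.2 ⟨a, b, Or.inl hb.symm⟩))
    (by
      rintro _ ⟨α, hα, a, rfl⟩ _ ⟨β, hβ, b, rfl⟩ hab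
      exact hst α hα β hβ (mem_tupleNbhd.2 ⟨a, b, Or.inr hab⟩))
  have hmeas : ∀ s : Finset (Λ n ℓ), Measurable fun (v : V s → S) (α : s) =>
      F α fun a => v ⟨(α : Λ n ℓ) a, α, α.2, a, rfl⟩ := fun s =>
    measurable_pi_lambda _ fun α => (hF α).comp (measurable_pi_lambda _ fun a =>
      measurable_pi_apply _)
  exact h1.comp (hmeas s) (hmeas t)

end Tuples

/-! ### Application to U-statistics -/

section Application

set_option linter.unusedSectionVars false

variable {Ω S : Type*} [MeasurableSpace Ω] [MeasurableSpace S] {μ : Measure Ω} {n ℓ : ℕ}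

theorem card_tuples_eq : (Fintype.card (Λ n ℓ) : ℝ) = (ℓ ! : ℝ) * (n.choose ℓ : ℝ) := by
  rw [Fintype.card_embedding_eq, Fintype.card_fin, Fintype.card_fin,
    Nat.descFactorial_eq_factorial_mul_choose, Nat.cast_mul]

theorem card_tuples_le : (Fintype.card (Λ n ℓ) : ℝ) ≤ (n : ℝ) ^ ℓ := by
  rw [Fintype.card_embedding_eq, Fintype.card_fin, Fintype.card_fin]
  exact_mod_cast Nat.descFactorial_le_pow n ℓ

theorem measurable_tuple {X : Fin n → Ω → S} (hX : ∀ k, Measurable (X k)) (α : Λ n ℓ) :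
    Measurable (tuple X α) :=
  measurable_pi_lambda _ fun i => hX (α i)

theorem vStat_eq_sum [Nonempty (Λ n ℓ)] (f : (Fin ℓ → S) → ℝ) (X : Fin n → Ω → S) (ω : Ω) :
    vStat f X ω = ∑ α : Λ n ℓ, f (tuple X α ω) := by
  have h : (ℓ ! : ℝ) * (n.choose ℓ : ℝ) ≠ 0 := by
    rw [← card_tuples_eq]
    exact_mod_cast Fintype.card_ne_zero
  rw [vStat, uStat, ← mul_assoc, mul_one_div_cancel h, one_mul]

theorem memLp_of_momentSum_lt_top {f : (Fin ℓ → S) → ℝ} {X : Fin n → Ω → S} {c : Λ n ℓ → ℝ}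
    {δ : ℝ} (hf : Measurable f) (hX : ∀ k, Measurable (X k)) (hδ : 0 < δ)
    (hA : momentSum f X c δ μ < ∞) (α : Λ n ℓ) :
    MemLp (fun ω => f (tuple X α ω) - c α) (ENNReal.ofReal δ) μ := by
  refine ⟨((hf.comp (measurable_tuple hX α)).sub_const _).aestronglyMeasurable, ?_⟩
  have h1 := ENNReal.sum_lt_top.1 hA α (Finset.mem_univ α)
  rwa [ENNReal.rpow_lt_top_iff_of_pos hδ] at h1

theorem integrable_abs_rpow_of_memLp {Y : Ω → ℝ} {δ : ℝ} (hδ : 0 < δ)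
    (hY : MemLp Y (ENNReal.ofReal δ) μ) : Integrable (fun ω => |Y ω| ^ δ) μ := by
  have := hY.integrable_norm_rpow (by simpa using hδ) ENNReal.ofReal_ne_top
  simpa only [ENNReal.toReal_ofReal hδ.le, Real.norm_eq_abs] using this

theorem toReal_momentSum {f : (Fin ℓ → S) → ℝ} {X : Fin n → Ω → S} {c : Λ n ℓ → ℝ} {δ : ℝ}
    (hδ : 0 < δ)
    (hY : ∀ α : Λ n ℓ, MemLp (fun ω => f (tuple X α ω) - c α) (ENNReal.ofReal δ) μ) :
    (momentSum f X c δ μ).toReal = ∑ α : Λ n ℓ, ∫ ω, |f (tuple X α ω) - c α| ^ δ ∂μ := by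
  have h0 : ∀ α : Λ n ℓ, 0 ≤ ∫ ω, |f (tuple X α ω) - c α| ^ δ ∂μ := fun α =>
    integral_nonneg fun ω => Real.rpow_nonneg (abs_nonneg _) _
  have h1 : ∀ α : Λ n ℓ, eLpNorm (fun ω => f (tuple X α ω) - c α) (ENNReal.ofReal δ) μ ^ δ =
      ENNReal.ofReal (∫ ω, |f (tuple X α ω) - c α| ^ δ ∂μ) := fun α => by
    rw [(hY α).eLpNorm_eq_integral_rpow_norm (by simpa using hδ) ENNReal.ofReal_ne_top,
      ENNReal.toReal_ofReal hδ.le]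
    simp only [Real.norm_eq_abs]
    rw [ENNReal.ofReal_rpow_of_nonneg (Real.rpow_nonneg (h0 α) _) hδ.le,
      Real.rpow_inv_rpow (h0 α) hδ.ne']
  unfold momentSum
  simp_rw [h1]
  rw [← ENNReal.ofReal_sum_of_nonneg fun α _ => h0 α,
    ENNReal.toReal_ofReal (Finset.sum_nonneg fun α _ => h0 α)]

variable [IsProbabilityMeasure μ]

/-- The terms of the U-statistic, shifted by `c α` and divided by the standard deviation `σ` of
`V_n`. -/
noncomputable def scaledTerm (f : (Fin ℓ → S) → ℝ) (X : Fin n → Ω → S) (c : Λ n ℓ → ℝ) (σ : ℝ)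
    (α : Λ n ℓ) (ω : Ω) : ℝ :=
  (f (tuple X α ω) - c α) / σ

/-- The shifts `c α` cancel in the centred sum. -/
theorem centeredSum_scaledTerm [Nonempty (Λ n ℓ)] {f : (Fin ℓ → S) → ℝ} {X : Fin n → Ω → S}
    {c : Λ n ℓ → ℝ} (hint : ∀ α : Λ n ℓ, Integrable (fun ω => f (tuple X α ω) - c α) μ) (σ : ℝ)
    (ω : Ω) : centeredSum (scaledTerm f X c σ) μ ω =
      (vStat f X ω - ∫ ω', vStat f X ω' ∂μ) / σ := by
  have h1 : ∀ α : Λ n ℓ, Integrable (fun ω => f (tuple X α ω)) μ := fun α =>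
    ((hint α).add (integrable_const (c α))).congr (Filter.Eventually.of_forall fun ω => by simp)
  simp_rw [vStat_eq_sum]
  rw [integral_finsetSum _ fun α _ => h1 α, ← Finset.sum_sub_distrib, Finset.sum_div]
  refine Finset.sum_congr rfl fun α _ => ?_
  simp only [scaledTerm]
  rw [integral_div, integral_sub (h1 α) (integrable_const _)]
  simp only [integral_const, probReal_univ, one_smul]
  ring

theorem normalizedLaw_eq [Nonempty (Λ n ℓ)] {f : (Fin ℓ → S) → ℝ} {X : Fin n → Ω → S}
    {c : Λ n ℓ → ℝ} (hint : ∀ α : Λ n ℓ, Integrable (fun ω => f (tuple X α ω) - c α) μ) :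
    normalizedLaw f X μ =
      μ.map (centeredSum (scaledTerm f X c (√(variance (vStat f X) μ))) μ) := by
  set K : ℝ := (ℓ ! : ℝ) * (n.choose ℓ : ℝ) with hK
  have hK0 : 0 < K := by
    rw [hK, ← card_tuples_eq]
    exact_mod_cast Fintype.card_pos
  have hvar : variance (vStat f X) μ = K ^ 2 * variance (uStat f X) μ :=
    variance_const_mul K (uStat f X) μ
  unfold normalizedLaw
  congr 1
  funext ω
  rw [centeredSum_scaledTerm hint, hvar, Real.sqrt_mul (sq_nonneg K), Real.sqrt_sq hK0.le]
  simp only [vStat]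
  rw [integral_const_mul, ← mul_sub, mul_div_mul_left _ _ hK0.ne']

theorem isLocallyDependent_scaledTerm {f : (Fin ℓ → S) → ℝ} {X : Fin n → Ω → S}
    {c : Λ n ℓ → ℝ} {m : ℕ} (hℓ : 1 ≤ ℓ) (hX : ∀ k, Measurable (X k)) (hf : Measurable f)
    {G : SimpleGraph (Fin n)} [DecidableRel G.Adj] (hG : IsDependencyGraph G X μ)
    (hm : G.maxDegree ≤ m)
    (hY : ∀ α : Λ n ℓ, MemLp (fun ω => f (tuple X α ω) - c α) 2 μ)
    (hvar : 0 < variance (vStat f X) μ) [Nonempty (Λ n ℓ)] :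
    IsLocallyDependent (scaledTerm f X c (√(variance (vStat f X) μ))) (tupleNbhd G)
      ((ℓ : ℝ) ^ 2 * ((m : ℝ) + 1) * (n : ℝ) ^ (ℓ - 1)) μ where
  measurable α := ((hf.comp (measurable_tuple hX α)).sub_const _).div_const _
  memLp α := by
    refine ((hY α).const_mul (√(variance (vStat f X) μ))⁻¹).congr_norm
      (((hf.comp (measurable_tuple hX α)).sub_const _).div_const _).aestronglyMeasurable
      (Filter.Eventually.of_forall fun ω => ?_)
    rw [scaledTerm, div_eq_inv_mul]
  mem_self α := mem_tupleNbhd.2 ⟨⟨0, hℓ⟩, ⟨0, hℓ⟩, Or.inl rfl⟩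
  mem_symm α β := by
    rw [mem_tupleNbhd, mem_tupleNbhd, exists_comm]
    simp only [eq_comm, G.adj_comm]
  card_le α := by exact_mod_cast card_tupleNbhd_le G hm α
  indep s t hst :=
    indepFun_of_tupleNbhd hG
      (F := fun α v => (f v - c α) / √(variance (vStat f X) μ))
      (fun α => (hf.sub_const _).div_const _) hst
  integral_sq := by
    have hint : ∀ α : Λ n ℓ, Integrable (fun ω => f (tuple X α ω) - c α) μ := fun α =>
      (hY α).integrable one_le_two
    simp_rw [centeredSum_scaledTerm hint, div_pow, Real.sq_sqrt hvar.le]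
    have hmeas : Measurable (vStat f X) := by
      have : vStat f X = fun ω => ∑ α : Λ n ℓ, f (tuple X α ω) := funext fun ω => vStat_eq_sum f X ω
      rw [this]
      exact Finset.measurable_fun_sum _ fun α _ => hf.comp (measurable_tuple hX α)
    rw [integral_div, ← variance_eq_integral hmeas.aemeasurable, div_self hvar.ne']

theorem integral_abs_scaledTerm_rpow {f : (Fin ℓ → S) → ℝ} {X : Fin n → Ω → S}
    {c : Λ n ℓ → ℝ} {σ : ℝ} (hσ : 0 < σ) (p : ℝ) (α : Λ n ℓ) :
    ∫ ω, |scaledTerm f X c σ α ω| ^ p ∂μ = (∫ ω, |f (tuple X α ω) - c α| ^ p ∂μ) / σ ^ p := by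
  rw [← integral_div]
  refine integral_congr_ae (Filter.Eventually.of_forall fun ω => ?_)
  simp only [scaledTerm]
  rw [abs_div, abs_of_pos hσ, Real.div_rpow (abs_nonneg _) hσ.le]

theorem integrable_abs_scaledTerm_rpow {f : (Fin ℓ → S) → ℝ} {X : Fin n → Ω → S}
    {c : Λ n ℓ → ℝ} {σ p : ℝ} (hσ : 0 < σ) {α : Λ n ℓ}
    (h : Integrable (fun ω => |f (tuple X α ω) - c α| ^ p) μ) :
    Integrable (fun ω => |scaledTerm f X c σ α ω| ^ p) μ := by
  refine (h.div_const (σ ^ p)).congr (Filter.Eventually.of_forall fun ω => ?_)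
  simp only [scaledTerm]
  rw [abs_div, abs_of_pos hσ, Real.div_rpow (abs_nonneg _) hσ.le]

end Application

end UStatistics

theorem mainTheorem6 {Ω S : Type*} [MeasurableSpace Ω] [MeasurableSpace S]
    (μ : Measure Ω) [IsProbabilityMeasure μ]
    (n ℓ m : ℕ) (hℓ : 1 ≤ ℓ)
    (X : Fin n → Ω → S) (hX : ∀ k, Measurable (X k))
    (G : SimpleGraph (Fin n)) [DecidableRel G.Adj]
    (hG : UStatistics.IsDependencyGraph G X μ) (hm : G.maxDegree ≤ m)
    (f : (Fin ℓ → S) → ℝ) (hf : Measurable f)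
    (c : UStatistics.Λ n ℓ → ℝ)
    (δ : ℝ) (hδ : 2 < δ)
    (hA_pos : 0 < UStatistics.momentSum f X c δ μ)
    (hA_fin : UStatistics.momentSum f X c δ μ < ∞)
    (hvar : variance (UStatistics.uStat f X) μ ≠ 0) :
    UStatistics.Xi f X c m δ μ ∈ Set.Ioc (0 : ℝ) 1 ∧
    (δ < 3 →
      UStatistics.kolDist (UStatistics.normalizedLaw f X μ) (gaussianReal 0 1) ≤
        8.015 * ((ℓ : ℝ) ^ 2 * ((m : ℝ) + 1) / (n : ℝ)) ^ ((δ - 2) / (2 * (δ + 1))) *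
          (UStatistics.Xi f X c m δ μ) ^ (-(δ / (δ + 1)))) ∧
    (3 ≤ δ →
      UStatistics.kolDist (UStatistics.normalizedLaw f X μ) (gaussianReal 0 1) ≤
        max
          (18.96 * ((ℓ : ℝ) ^ 2 * ((m : ℝ) + 1) / (n : ℝ)) ^ ((δ - 2) / (2 * (δ + 1))) *
            (UStatistics.Xi f X c m δ μ) ^ (-(δ / (δ + 1))))
          (227.5 * √((ℓ : ℝ) ^ 2 * ((m : ℝ) + 1) / (n : ℝ)) *
            (UStatistics.Xi f X c m δ μ) ^ (-3 : ℤ))) := by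
  open UStatistics in
  have hδ0 : 0 < δ := by linarith
  -- A nonzero moment sum excludes the degenerate case without tuples.
  have hne : Nonempty (Λ n ℓ) := by
    by_contra hempty
    rw [not_nonempty_iff] at hempty
    simp [momentSum] at hA_pos
  have hn : 0 < (n : ℝ) := by
    obtain ⟨α⟩ := hne
    exact_mod_cast (α ⟨0, hℓ⟩).pos
  have hℓ0 : 0 < (ℓ : ℝ) := by exact_mod_cast hℓ
  have hY : ∀ α : Λ n ℓ, MemLp (fun ω => f (tuple X α ω) - c α) (ENNReal.ofReal δ) μ :=
    memLp_of_momentSum_lt_top hf hX hδ0 hA_fin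
  have hY2 : ∀ α : Λ n ℓ, MemLp (fun ω => f (tuple X α ω) - c α) 2 μ := fun α =>
    (hY α).mono_exponent (by
      rw [← ENNReal.ofReal_ofNat]
      exact ENNReal.ofReal_le_ofReal hδ.le)
  have hYint : ∀ α : Λ n ℓ, Integrable (fun ω => f (tuple X α ω) - c α) μ := fun α =>
    (hY2 α).integrable one_le_two
  have hYδ : ∀ α : Λ n ℓ, Integrable (fun ω => |f (tuple X α ω) - c α| ^ δ) μ := fun α =>
    integrable_abs_rpow_of_memLp hδ0 (hY α)
  set card : ℝ := ((Fintype.card (Λ n ℓ) : ℕ) : ℝ) with hcard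
  have hcard0 : 0 < card := by
    rw [hcard]
    exact_mod_cast Fintype.card_pos
  set A : ℝ := (momentSum f X c δ μ).toReal with hA
  have hA0 : 0 < A := ENNReal.toReal_pos hA_pos.ne' hA_fin.ne
  set a : ℝ := meanNorm f X c δ μ with ha
  have ha0 : 0 < a := Real.rpow_pos_of_pos (div_pos hA0 hcard0) _
  have haδ : card * a ^ δ = A := by
    rw [ha, meanNorm, ← Real.rpow_mul (div_pos hA0 hcard0).le, one_div_mul_cancel hδ0.ne',
      Real.rpow_one, mul_div_cancel₀ _ hcard0.ne']
  have hsum : ∑ α : Λ n ℓ, ∫ ω, |f (tuple X α ω) - c α| ^ δ ∂μ = card * a ^ δ := by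
    rw [haδ, hA, toReal_momentSum hδ0 hY]
  have hvarV : 0 < variance (vStat f X) μ := by
    have h1 : variance (vStat f X) μ =
        ((ℓ ! : ℝ) * (n.choose ℓ : ℝ)) ^ 2 * variance (uStat f X) μ :=
      variance_const_mul _ (uStat f X) μ
    rw [h1, ← card_tuples_eq]
    exact mul_pos (pow_pos hcard0 2) (lt_of_le_of_ne (variance_nonneg _ _) hvar.symm)
  set σ : ℝ := √(variance (vStat f X) μ) with hσ
  have hσ0 : 0 < σ := Real.sqrt_pos.2 hvarV
  set D : ℝ := (ℓ : ℝ) ^ 2 * ((m : ℝ) + 1) * (n : ℝ) ^ (ℓ - 1) with hD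
  have hD0 : 0 < D := by positivity
  set M : ℝ := (n : ℝ) ^ ℓ with hM
  have hM0 : 0 < M := by positivity
  have hcardM : card ≤ M := card_tuples_le
  have hloc := isLocallyDependent_scaledTerm (c := c) hℓ hX hf hG hm hY2 hvarV
  rw [normalizedLaw_eq hYint]
  set η : Λ n ℓ → Ω → ℝ := scaledTerm f X c σ with hη
  have hDM : (ℓ : ℝ) ^ 2 * ((m : ℝ) + 1) * (n : ℝ) ^ (2 * ℓ - 1) = D * M := by
    rw [hD, hM, mul_assoc _ ((n : ℝ) ^ (ℓ - 1)), ← pow_add]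
    congr 2
    omega
  have hr : (ℓ : ℝ) ^ 2 * ((m : ℝ) + 1) / (n : ℝ) = D / M := by
    rw [hD, hM, div_eq_div_iff hn.ne' (by positivity), mul_assoc _ ((n : ℝ) ^ (ℓ - 1)),
      ← pow_succ, Nat.sub_add_cancel hℓ]
  set Ξ : ℝ := Xi f X c m δ μ with hΞdef
  have hΞ : Ξ = σ / (a * √(D * M)) := by
    rw [hΞdef, Xi, ← ha, hDM, Real.sqrt_div hvarV.le, ← hσ, one_div_mul_eq_div, div_div,
      mul_comm a]
  have hDM0 : 0 < √(D * M) := Real.sqrt_pos.2 (by positivity)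
  have hΞ0 : 0 < Ξ := by
    rw [hΞ]
    positivity
  have hσΞ : σ = Ξ * a * √(D * M) := by
    rw [hΞ]
    field_simp
  -- The moments of order `q ≤ δ` of the scaled terms.
  have hmom : ∀ q : ℝ, 0 ≤ q → q ≤ δ → D ^ (q - 1) * ∑ α, ∫ ω, |η α ω| ^ q ∂μ ≤
      (D / M) ^ ((q - 2) / 2) * Ξ ^ (-q) := by
    intro q hq hqδ
    have h1 : ∑ α, ∫ ω, |η α ω| ^ q ∂μ =
        (∑ α : Λ n ℓ, ∫ ω, |f (tuple X α ω) - c α| ^ q ∂μ) / σ ^ q := by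
      rw [Finset.sum_div]
      exact Finset.sum_congr rfl fun α _ => integral_abs_scaledTerm_rpow hσ0 q α
    rw [h1]
    refine moment_scaling hD0 hM0 ha0 hΞ0 hσΞ ?_
    refine (sum_integral_rpow_le hq hqδ hδ0 ha0 hYδ hsum).trans ?_
    exact mul_le_mul_of_nonneg_right hcardM (by positivity)
  have hint : ∀ α, Integrable (fun ω => |η α ω| ^ δ) μ := fun α =>
    integrable_abs_scaledTerm_rpow hσ0 (hYδ α)
  set r : ℝ := D / M with hrdef
  have hr0 : 0 < r := div_pos hD0 hM0
  rw [hr]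
  set x : ℝ := r ^ ((δ - 2) / (2 * (δ + 1))) * Ξ ^ (-(δ / (δ + 1))) with hx
  have hx0 : 0 < x := by positivity
  have hxpow : x ^ (δ + 1) = r ^ ((δ - 2) / 2) * Ξ ^ (-δ) := by
    rw [hx, Real.mul_rpow (by positivity) (by positivity), ← Real.rpow_mul hr0.le,
      ← Real.rpow_mul hΞ0.le]
    have h1 : δ + 1 ≠ 0 := by linarith
    congr 2 <;> field_simp
  have hMx : D ^ (δ - 1) * ∑ α, ∫ ω, |η α ω| ^ δ ∂μ ≤ x ^ (δ + 1) := by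
    rw [hxpow]
    exact hmom δ hδ0.le le_rfl
  have := Measure.isProbabilityMeasure_map (μ := μ) hloc.measurable_centeredSum.aemeasurable
  have hkol1 : kolDist (μ.map (centeredSum η μ)) (gaussianReal 0 1) ≤ 1 := kolDist_le_one
  refine ⟨⟨hΞ0, ?_⟩, fun hδ3 => ?_, fun hδ3 => ?_⟩
  · have h1 := hloc.one_le_mul_sum_sq
    have h2 := hmom 2 zero_le_two hδ.le
    simp only [Real.rpow_ofNat, sq_abs] at h2
    rw [sub_self, zero_div, Real.rpow_zero, one_mul, show (2 : ℝ) - 1 = 1 by norm_num,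
      Real.rpow_one] at h2
    have h3 := h1.trans h2
    by_contra hcon
    exact absurd h3 (not_le.2 (Real.rpow_lt_one_of_one_lt_of_neg (not_le.1 hcon) (by norm_num)))
  · rw [mul_assoc, ← hx]
    -- For `x > 1 / 8` the right-hand side exceeds one.
    rcases le_or_gt x (1 / 8) with hx8 | hx8
    · have := hloc.kolDist_le_of_le_three hD0 hδ hδ3.le hint hx0 hx8 hMx
      linarith
    · linarith
  · rw [mul_assoc, ← hx, mul_assoc 227.5]
    set y : ℝ := √r * Ξ ^ (-3 : ℤ) with hy
    have hy0 : 0 ≤ y := by positivity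
    -- For `x > 1 / 18` the first term of the maximum exceeds one.
    rcases le_or_gt x (1 / 18) with hx18 | hx18
    · have hint3 : ∀ α, Integrable (fun ω => |η α ω| ^ (3 : ℝ)) μ := fun α => by
        refine integrable_abs_scaledTerm_rpow hσ0 (integrable_abs_rpow_of_memLp (by norm_num) ?_)
        exact (hY α).mono_exponent (ENNReal.ofReal_le_ofReal hδ3)
      have hβ : D ^ 2 * ∑ α, ∫ ω, |η α ω| ^ (3 : ℝ) ∂μ ≤ y := by
        have h1 := hmom 3 (by norm_num) hδ3
        rw [show (3 : ℝ) - 1 = (2 : ℕ) by norm_num, Real.rpow_natCast,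
          show ((3 : ℝ) - 2) / 2 = 1 / 2 by norm_num, ← Real.sqrt_eq_rpow,
          show (-3 : ℝ) = ((-3 : ℤ) : ℝ) by norm_num, Real.rpow_intCast] at h1
        exact h1
      have h2 := hloc.kolDist_le_of_three_le hD0 hδ3 hint hint3 hx0 hx18 hMx hy0 hβ
      -- The coefficients fit, since `133 / 227.5 + 6.3 / 18.96 < 1`.
      have h3 := le_max_left (18.96 * x) (227.5 * y)
      have h4 := le_max_right (18.96 * x) (227.5 * y)
      linarith
    · refine hkol1.trans (le_trans ?_ (le_max_left _ _))
      linarith
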